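/- Work in the category $\mathrm{sSet}$ of simplicial sets, and use the following terminology. * The *inner anodyne* maps are the maps in the saturated class (closed under coproducts, pushouts, transfinite composition and retracts) generated by the inner horn inclusions $\Lambda^n_i\subseteq\Delta^n$, $0<i<n$. Equivalently, they are the maps with the left lifting property with respect to all *inner fibrations*, i.e. with respect to all maps that have the right lifting property with respect to these inner horn inclusions. * An *$\infty$-category* is a simplicial set in which every inner horn $\Lambda^n_i\to\mathcal C$, $0<i<n$, extends to $\Delta^n$. An edge of an $\infty$-category $\mathcal C$ is an *equivalence* if its image in the homotopy category $\mathrm h(\mathcal C)$ is an isomorphism. A map $f\colon\mathcal C\to\mathcal D$ of $\infty$-categories is an *equivalence* if there is a map $g\colon\mathcal D\to\mathcal C$ such that there are equivalences $gf\to\mathrm{id}_{\mathcal C}$ and $fg\to\mathrm{id}_{\mathcal D}$ in the $\infty$-categories $\mathrm{Fun}(\mathcal C,\mathcal C)$ and $\mathrm{Fun}(\mathcal D,\mathcal D)$ respectively. * A map $f\colon S\to T$ of simplicial sets is a *categorical equivalence* if for every $\infty$-category $\mathcal C$ the induced map $\mathrm{Fun}(T,\mathcal C)\to\mathrm{Fun}(S,\mathcal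 C)$ is an equivalence of $\infty$-categories. * A map is *bijective on objects* if it is bijective on $0$-simplices. A *trivial Kan fibration* is a map with the right lifting property with respect to the inclusions $\partial\Delta^n\subseteq\Delta^n$ for all $n\ge 0$. **Proposition.** The following statements are equivalent: 1. The class of inner anodyne maps satisfies the 2-out-of-3 property in the class of monomorphisms of simplicial sets: if $u\colon A\to B$ and $v\colon B\to C$ are monomorphisms such that any two of $u$, $v$ and $vu$ are inner anodyne, then all three are inner anodyne. 2. Every monic categorical equivalence which is bijective on objects is inner anodyne. 3. Every inner fibration $p\colon X\to S$ between simplicial sets which is bijective on objects and a categorical equivalence is a trivial Kan fibration. -/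

import Mathlib

open CategoryTheory Simplicial MonoidalCategory

universe u

namespace SSet

noncomputable section

/-- The simplicial set `Fun(X, Y)` of maps from `X` to `Y`: the internal hom of simplicial sets. -/
abbrev Fun (X Y : SSet.{u}) : SSet.{u} := (ihom X).obj Y

/-- The map `Fun(T, C) ⟶ Fun(S, C)` given by precomposition with `f : S ⟶ T`. -/
abbrev Fun.precomp {S T : SSet.{u}} (f : S ⟶ T) (C : SSet.{u}) : Fun T C ⟶ Fun S C :=
  (MonoidalClosed.pre f).app C

/-- A map `f : X ⟶ Y`, regarded as a vertex of `Fun(X, Y)`. -/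
def Fun.vertex {X Y : SSet.{u}} (f : X ⟶ Y) : (Fun X Y) _⦋0⦌ :=
  (Fun X Y).unitHomEquiv (MonoidalClosed.curry' f)

/-- An edge of a simplicial set `X` is an equivalence if its image in the homotopy category
of `X` is an isomorphism. (The category `hoFunctor.obj X` is by definition the homotopy category
of the `2`-truncation of `X`.) -/
def Edge.IsEquivalence {X : SSet.{u}} {x y : X _⦋0⦌} (e : Edge x y) : Prop :=
  IsIso (Truncated.HomotopyCategory.homMk e.toTruncated)

/-- A map `f : C ⟶ D` of `∞`-categories is an equivalence if there is a map `g : D ⟶ C` together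
with equivalences `g f → id_C` and `f g → id_D` in `Fun(C, C)` and `Fun(D, D)`. -/
def IsEquivalenceOfQuasicategories {C D : SSet.{u}} [Quasicategory C] [Quasicategory D]
    (f : C ⟶ D) : Prop :=
  ∃ g : D ⟶ C,
    (∃ e : Edge (Fun.vertex (f ≫ g)) (Fun.vertex (𝟙 C)), e.IsEquivalence) ∧
    (∃ e : Edge (Fun.vertex (g ≫ f)) (Fun.vertex (𝟙 D)), e.IsEquivalence)

/-- A map `f : S ⟶ T` of simplicial sets is a categorical equivalence if, for every `∞`-category
`C`, the map `Fun(T, C) ⟶ Fun(S, C)` is an equivalence of `∞`-categories. -/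
def IsCategoricalEquivalence {S T : SSet.{u}} (f : S ⟶ T) : Prop :=
  ∀ (C : SSet.{u}) [Quasicategory C], IsEquivalenceOfQuasicategories (Fun.precomp f C)

/-- A map of simplicial sets is bijective on objects if it is bijective on vertices. -/
def IsBijectiveOnObjects {S T : SSet.{u}} (f : S ⟶ T) : Prop :=
  Function.Bijective (fun x : S _⦋0⦌ => (f.app (Opposite.op ⦋0⦌) x : T _⦋0⦌))

/-- A trivial Kan fibration is a map of simplicial sets with the right lifting property with
respect to the boundary inclusions `∂Δ[n] ⟶ Δ[n]` for all `n ≥ 0`. -/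
def IsTrivialKanFibration {X Y : SSet.{u}} (p : X ⟶ Y) : Prop :=
  ∀ n : ℕ, HasLiftingProperty (∂Δ[n] : (Δ[n] : SSet.{u}).Subcomplex).ι p

end

end SSet

/-! The heart of the matter is a case of (3) that holds unconditionally: an inner fibration between
∞-categories which is bijective on objects and a categorical equivalence is a trivial Kan fibration
(`isTrivialKanFibration_of_quasicategory`).

Granting it, let `f : A ⟶ B` be as in (2) and let `i` be an inner anodyne map from `B` to an
∞-category. Factor `f ≫ i` as an inner anodyne map followed by an inner fibration. The fibration is
trivial by the special case, so `f ≫ i` is a retract of an inner anodyne map, and (1) cancels `i`.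
Conversely, inner anodyne maps are categorical equivalences bijective on objects, and both of these
classes satisfy 2-out-of-3; this gives (2) ⇒ (1). The equivalence of (2) and (3) consists of two
retract arguments.

For the special case `p : X ⟶ Y`, precomposition with `p` is essentially surjective and full on
homotopy categories. This yields `g : Y ⟶ X`, an invertible `K` from `𝟙 X` to `p ≫ g`, and `H` from
`𝟙 Y` to `g ≫ p`; since `Fun(X, X) ⟶ Fun(X, Y)` is an inner fibration, `K` can be corrected so that
`K` and `H` agree strictly over `p`. A lifting problem `(u, v)` against `∂Δ[n] ⊆ Δ[n]`, `n > 0`, is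
then solved by lifting `H` applied to `v` over the prism `Δ[n] ⊗ Δ[1]`, with values prescribed on
`∂Δ[n] ⊗ Δ[1] ∪ Δ[n] ⊗ {1}`, and restricting to `Δ[n] ⊗ {0}`.

The prism is built by attaching simplices along inner horns, except for one last horn whose last
edge goes to an invertible edge. Such horns lift by Joyal's theorem (`exists_lift_last_horn`),
proved by décalage: `Dec X ⟶ Dec Y ×_Y X` lowers horn dimension and index by one, and turns an inner
fibration into a left fibration. -/

namespace SSet
open Opposite

/-! ### Horn filling in terms of simplices -/

section HornFilling

variable {X Y : SSet.{u}}

/-- The faces `y j`, `j ≠ i`, of an `(n + 2)`-simplex fit together to a horn `Λ[n + 2, i]`. -/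
def HornCompatible {n : ℕ} (i : Fin (n + 3)) (y : Fin (n + 3) → X _⦋n + 1⦌) : Prop :=
  ∀ (j k : Fin (n + 3)) (_ : j ≠ i) (_ : k ≠ i) (hjk : j < k),
    X.δ (k.pred (Fin.ne_zero_of_lt hjk)) (y j) =
      X.δ (j.castPred (Fin.ne_last_of_lt hjk)) (y k)

/-- The map `p` has the right lifting property with respect to the horn `Λ[n + 2, i]`, in terms
of simplices. -/
def FillsHorn (p : X ⟶ Y) {n : ℕ} (i : Fin (n + 3)) : Prop :=
  ∀ y : Fin (n + 3) → X _⦋n + 1⦌, HornCompatible i y → ∀ η : Y _⦋n + 2⦌,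
    (∀ j, j ≠ i → Y.δ j η = p.app _ (y j)) →
      ∃ x : X _⦋n + 2⦌, (∀ j, j ≠ i → X.δ j x = y j) ∧ p.app _ x = η

lemma HornCompatible.isCompatible {n : ℕ} {i : Fin (n + 3)} {y : Fin (n + 3) → X _⦋n + 1⦌}
    (hy : HornCompatible i y) :
    horn.IsCompatible (i := i) (fun j _ ↦ yonedaEquiv.symm (y j)) := by
  rw [horn.isCompatible_iff]
  intro j k hj hk hjk
  rw [stdSimplex.δ_comp_yonedaEquiv_symm, stdSimplex.δ_comp_yonedaEquiv_symm, hy j k hj hk hjk]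

lemma FillsHorn.exists_lift {p : X ⟶ Y} {n : ℕ} {i : Fin (n + 3)}
    {f : (Λ[n + 2, i] : SSet.{u}) ⟶ X} {g : Δ[n + 2] ⟶ Y}
    (h : ∃ x : X _⦋n + 2⦌, (∀ j (hj : j ≠ i), X.δ j x = yonedaEquiv (horn.ι i j hj ≫ f)) ∧
      p.app _ x = yonedaEquiv g) :
    ∃ l : Δ[n + 2] ⟶ X, Λ[n + 2, i].ι ≫ l = f ∧ l ≫ p = g := by
  obtain ⟨x, h₁, h₂⟩ := h
  refine ⟨yonedaEquiv.symm x, horn.hom_ext' fun j hj ↦ ?_, ?_⟩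
  · rw [horn.ι_ι_assoc, stdSimplex.δ_comp_yonedaEquiv_symm, h₁ j hj, Equiv.symm_apply_apply]
  · rw [yonedaEquiv_symm_comp, h₂, Equiv.symm_apply_apply]

lemma hornCompatible_of_hom {n : ℕ} {i : Fin (n + 3)} (f : (Λ[n + 2, i] : SSet.{u}) ⟶ X)
    {y : Fin (n + 3) → X _⦋n + 1⦌} (hy : ∀ j hj, y j = yonedaEquiv (horn.ι i j hj ≫ f)) :
    HornCompatible i y := by
  intro j k hj hk hjk
  have := (horn.IsCompatible.of_hom f).δ_pred_comp j k hj hk hjk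
  apply_fun yonedaEquiv at this
  rwa [stdSimplex.yonedaEquiv_δ_comp, stdSimplex.yonedaEquiv_δ_comp, ← hy, ← hy] at this

lemma exists_faces_of_hom {n : ℕ} {i : Fin (n + 3)} (f : (Λ[n + 2, i] : SSet.{u}) ⟶ X) :
    ∃ y : Fin (n + 3) → X _⦋n + 1⦌, ∀ j hj, y j = yonedaEquiv (horn.ι i j hj ≫ f) := by
  classical
  -- The value at `j = i` is never used; an arbitrary face serves as default.
  exact ⟨fun j ↦ if hj : j ≠ i then yonedaEquiv (horn.ι i j hj ≫ f) else
    yonedaEquiv (horn.ι i (i.succAbove 0) (Fin.succAbove_ne _ _) ≫ f), fun j hj ↦ by simp [hj]⟩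

lemma fillsHorn_iff (p : X ⟶ Y) {n : ℕ} (i : Fin (n + 3)) :
    FillsHorn p i ↔ HasLiftingProperty Λ[n + 2, i].ι p := by
  refine ⟨fun h ↦ ⟨fun {f g} sq ↦ ?_⟩, fun h y hy η hη ↦ ?_⟩
  · obtain ⟨y, hy⟩ := exists_faces_of_hom f
    obtain ⟨x, h₁, h₂⟩ := h y (hornCompatible_of_hom f hy) (yonedaEquiv g) (fun j hj ↦ by
      rw [hy j hj, ← stdSimplex.yonedaEquiv_δ_comp, ← yonedaEquiv_comp, Category.assoc, sq.w,
        horn.ι_ι_assoc])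
    obtain ⟨l, h₃, h₄⟩ := FillsHorn.exists_lift ⟨x, fun j hj ↦ (h₁ j hj).trans (hy j hj), h₂⟩
    exact ⟨⟨⟨l, h₃, h₄⟩⟩⟩
  · have sq : CommSq hy.isCompatible.desc Λ[n + 2, i].ι p (yonedaEquiv.symm η) :=
      ⟨horn.hom_ext' (fun j hj ↦ by
        rw [horn.IsCompatible.ι_desc_assoc, horn.ι_ι_assoc, stdSimplex.δ_comp_yonedaEquiv_symm,
          hη j hj, yonedaEquiv_symm_comp])⟩
    refine ⟨yonedaEquiv sq.lift, fun j hj ↦ ?_, ?_⟩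
    · rw [← stdSimplex.yonedaEquiv_δ_comp, ← horn.ι_ι i j hj, Category.assoc, sq.fac_left,
        horn.IsCompatible.ι_desc, Equiv.apply_symm_apply]
    · rw [← yonedaEquiv_comp, sq.fac_right, Equiv.apply_symm_apply]

lemma innerFibrations_iff_fillsHorn (p : X ⟶ Y) :
    innerFibrations p ↔
      ∀ (n : ℕ) (i : Fin (n + 3)), 0 < i → i < Fin.last _ → FillsHorn p i := by
  refine ⟨fun h n i h₀ h₁ ↦ (fillsHorn_iff p i).2 (h _ (horn_ι_mem_innerHornInclusions h₀ h₁)), ?_⟩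
  rintro h _ _ _ ⟨i, h₀, h₁⟩
  exact (fillsHorn_iff p i).1 (h _ i h₀ h₁)

end HornFilling

/-! ### Horns of dimension two -/

section LowDimension

variable {X Y : SSet.{u}} {p : X ⟶ Y}

lemma FillsHorn.two_one (h : FillsHorn p (1 : Fin 3)) (a b : X _⦋1⦌) (hab : X.δ 0 a = X.δ 1 b)
    (η : Y _⦋2⦌) (ha : Y.δ 2 η = p.app _ a) (hb : Y.δ 0 η = p.app _ b) :
    ∃ x : X _⦋2⦌, X.δ 2 x = a ∧ X.δ 0 x = b ∧ p.app _ x = η := by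
  obtain ⟨x, h₁, h₂⟩ := h ![b, b, a] (by
    intro j k hj hk hjk
    fin_cases j <;> fin_cases k <;> simp at hj hk hjk
    exact hab.symm) η (by
    intro j hj
    fin_cases j
    · exact hb
    · simp at hj
    · exact ha)
  exact ⟨x, h₁ 2 (by simp), h₁ 0 (by simp), h₂⟩

lemma FillsHorn.two_zero (h : FillsHorn p (0 : Fin 3)) (a b : X _⦋1⦌) (hab : X.δ 1 a = X.δ 1 b)
    (η : Y _⦋2⦌) (ha : Y.δ 2 η = p.app _ a) (hb : Y.δ 1 η = p.app _ b) :
    ∃ x : X _⦋2⦌, X.δ 2 x = a ∧ X.δ 1 x = b ∧ p.app _ x = η := by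
  obtain ⟨x, h₁, h₂⟩ := h ![b, b, a] (by
    intro j k hj hk hjk
    fin_cases j <;> fin_cases k <;> simp at hj hk hjk
    exact hab.symm) η (by
    intro j hj
    fin_cases j
    · simp at hj
    · exact hb
    · exact ha)
  exact ⟨x, h₁ 2 (by simp), h₁ 1 (by simp), h₂⟩

end LowDimension

/-! ### The homotopy category of an ∞-category via homotopy classes of edges -/

section Truncated

variable {X : SSet.{u}}

lemma δ_one_one_eq (x : X _⦋2⦌) : X.δ 1 (X.δ (1 : Fin 3) x) = X.δ 1 (X.δ 2 x) :=
  (X.δ_comp_δ_apply (i := 1) (j := 1) le_rfl x).symm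

lemma δ_zero_one_eq (x : X _⦋2⦌) : X.δ 0 (X.δ (1 : Fin 3) x) = X.δ 0 (X.δ 0 x) :=
  X.δ_comp_δ_apply (i := 0) (j := 0) le_rfl x

lemma δ_zero_σ_zero (x : X _⦋0⦌) : X.δ 0 (X.σ 0 x) = x := X.δ_comp_σ_self_apply 0 x

lemma δ_one_σ_zero (x : X _⦋0⦌) : X.δ 1 (X.σ 0 x) = x := X.δ_comp_σ_succ_apply 0 x

variable [Quasicategory X]

lemma Quasicategory.exists_filler {n : ℕ} (i : Fin (n + 3)) (h₀ : 0 < i) (h₁ : i < Fin.last _)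
    (y : Fin (n + 3) → X _⦋n + 1⦌) (hy : HornCompatible i y) :
    ∃ x : X _⦋n + 2⦌, ∀ j, j ≠ i → X.δ j x = y j := by
  obtain ⟨σ, hσ⟩ := Quasicategory.hornFilling h₀ h₁ hy.isCompatible.desc
  refine ⟨yonedaEquiv σ, fun j hj ↦ ?_⟩
  rw [← stdSimplex.yonedaEquiv_δ_comp, ← horn.ι_ι i j hj, Category.assoc, ← hσ,
    horn.IsCompatible.ι_desc, Equiv.apply_symm_apply]

lemma Edge.exists_comp {x₀ x₁ x₂ : X _⦋0⦌} (e₀₁ : Edge x₀ x₁) (e₁₂ : Edge x₁ x₂) :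
    ∃ e₀₂ : Edge x₀ x₂, Nonempty (CompStruct e₀₁ e₁₂ e₀₂) := by
  obtain ⟨x, hx⟩ := Quasicategory.exists_filler (1 : Fin 3) (by simp) (by decide)
    ![e₁₂.edge, e₁₂.edge, e₀₁.edge] (by
      intro j k hj hk hjk
      fin_cases j <;> fin_cases k <;> simp at hj hk hjk
      simp)
  have h₂ := hx 2 (by simp)
  have h₀ := hx 0 (by simp)
  refine ⟨.mk (X.δ 1 x) ?_ ?_, ⟨.mk x h₂ h₀ rfl⟩⟩
  · rw [δ_one_one_eq, h₂]; exact e₀₁.src_eq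
  · rw [δ_zero_one_eq, h₀]; exact e₁₂.tgt_eq

/-- The three conditions are fillings of `Λ[2, 1]`, `Λ[3, 1]` and `Λ[3, 2]`. They make available the
model of the homotopy category whose morphisms are homotopy classes of edges. -/
instance : Truncated.Quasicategory₂ ((truncation 2).obj X) where
  fill21 e₀₁ e₁₂ := by
    obtain ⟨e₀₂, ⟨h⟩⟩ := Edge.exists_comp (X := X) (.ofTruncated e₀₁) (.ofTruncated e₁₂)
    exact ⟨⟨e₀₂, h⟩⟩
  fill31 {x₀ x₁ x₂ x₃ e₀₁ e₁₂ e₂₃ e₀₂ e₁₃ e₀₃} f₃ f₀ f₂ := by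
    let g₃ : Edge.CompStruct (X := X) (.ofTruncated e₀₁) (.ofTruncated e₁₂) (.ofTruncated e₀₂) := f₃
    let g₀ : Edge.CompStruct (X := X) (.ofTruncated e₁₂) (.ofTruncated e₂₃) (.ofTruncated e₁₃) := f₀
    let g₂ : Edge.CompStruct (X := X) (.ofTruncated e₀₁) (.ofTruncated e₁₃) (.ofTruncated e₀₃) := f₂
    obtain ⟨x, hx⟩ := Quasicategory.exists_filler (1 : Fin 4) (by simp) (by decide)
      ![g₀.simplex, g₀.simplex, g₂.simplex, g₃.simplex] (by
        intro j k hj hk hjk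
        fin_cases j <;> fin_cases k <;> simp at hj hk hjk
        · exact g₀.d₁.trans g₂.d₀.symm
        · exact g₀.d₂.trans g₃.d₀.symm
        · exact g₂.d₂.trans g₃.d₂.symm)
    have h₀ : X.δ 0 x = g₀.simplex := hx 0 (by simp)
    have h₂ : X.δ 2 x = g₂.simplex := hx 2 (by simp)
    have h₃ : X.δ 3 x = g₃.simplex := hx 3 (by simp)
    refine ⟨Edge.CompStruct.mk (X := X) (e₀₁ := .ofTruncated e₀₂) (e₁₂ := .ofTruncated e₂₃)
      (e₀₂ := .ofTruncated e₀₃) (X.δ 1 x) ?_ ?_ ?_⟩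
    · exact (X.δ_comp_δ_apply (i := 1) (j := 2) (by decide) x).symm.trans
        ((congr_arg _ h₃).trans g₃.d₁)
    · exact (X.δ_comp_δ_apply (i := 0) (j := 0) le_rfl x).trans ((congr_arg _ h₀).trans g₀.d₀)
    · exact (X.δ_comp_δ_apply (i := 1) (j := 1) le_rfl x).symm.trans
        ((congr_arg _ h₂).trans g₂.d₁)
  fill32 {x₀ x₁ x₂ x₃ e₀₁ e₁₂ e₂₃ e₀₂ e₁₃ e₀₃} f₃ f₀ f₁ := by
    let g₃ : Edge.CompStruct (X := X) (.ofTruncated e₀₁) (.ofTruncated e₁₂) (.ofTruncated e₀₂) := f₃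
    let g₀ : Edge.CompStruct (X := X) (.ofTruncated e₁₂) (.ofTruncated e₂₃) (.ofTruncated e₁₃) := f₀
    let g₁ : Edge.CompStruct (X := X) (.ofTruncated e₀₂) (.ofTruncated e₂₃) (.ofTruncated e₀₃) := f₁
    obtain ⟨x, hx⟩ := Quasicategory.exists_filler (2 : Fin 4) (by simp) (by decide)
      ![g₀.simplex, g₁.simplex, g₁.simplex, g₃.simplex] (by
        intro j k hj hk hjk
        fin_cases j <;> fin_cases k <;> simp at hj hk hjk
        · exact g₀.d₀.trans g₁.d₀.symm
        · exact g₀.d₂.trans g₃.d₀.symm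
        · exact g₁.d₂.trans g₃.d₁.symm)
    have h₀ : X.δ 0 x = g₀.simplex := hx 0 (by simp)
    have h₁ : X.δ 1 x = g₁.simplex := hx 1 (by simp)
    have h₃ : X.δ 3 x = g₃.simplex := hx 3 (by simp)
    refine ⟨Edge.CompStruct.mk (X := X) (e₀₁ := .ofTruncated e₀₁) (e₁₂ := .ofTruncated e₁₃)
      (e₀₂ := .ofTruncated e₀₃) (X.δ 2 x) ?_ ?_ ?_⟩
    · exact (X.δ_comp_δ_apply (i := 2) (j := 2) (by decide) x).symm.trans
        ((congr_arg _ h₃).trans g₃.d₂)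
    · exact (X.δ_comp_δ_apply (i := 0) (j := 1) (by decide) x).trans
        ((congr_arg _ h₀).trans g₀.d₁)
    · exact (X.δ_comp_δ_apply (i := 1) (j := 1) le_rfl x).trans
        ((congr_arg _ h₁).trans g₁.d₁)

end Truncated

/-! ### Invertible edges and maps induced on homotopy categories -/

section Invertible

/-- The morphism in the homotopy category `HomotopyCategory₂` given by an edge of an
`∞`-category. -/
def Edge.homMk₂ {X : SSet.{u}} [Quasicategory X] {x y : X _⦋0⦌} (e : Edge x y) :
    Truncated.HomotopyCategory₂.mk (A := (truncation 2).obj X) x ⟶ .mk y :=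
  Truncated.HomotopyCategory₂.homMk e.toTruncated

variable {X Y : SSet.{u}} [Quasicategory X] [Quasicategory Y] {x y z : X _⦋0⦌}

lemma Edge.homMk₂_surjective : Function.Surjective (homMk₂ : Edge x y → _) :=
  Truncated.HomotopyCategory₂.homMk_surjective

lemma Edge.homMk₂_id (x : X _⦋0⦌) : (Edge.id x).homMk₂ = 𝟙 _ := rfl

lemma Edge.CompStruct.nonempty_iff {f : Edge x y} {g : Edge y z} {h : Edge x z} :
    Nonempty (CompStruct f g h) ↔ f.homMk₂ ≫ g.homMk₂ = h.homMk₂ :=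
  Truncated.Edge.CompStruct.nonempty_iff

lemma Edge.CompStruct.fac {f : Edge x y} {g : Edge y z} {h : Edge x z} (c : CompStruct f g h) :
    f.homMk₂ ≫ g.homMk₂ = h.homMk₂ := nonempty_iff.1 ⟨c⟩

lemma Edge.nonempty_invStruct_iff_isIso (e : Edge x y) :
    Nonempty e.InvStruct ↔ IsIso e.homMk₂ := by
  refine ⟨fun ⟨h⟩ ↦ ⟨⟨h.inv.homMk₂, h.homInvId.fac, h.invHomId.fac⟩⟩, fun h ↦ ?_⟩
  obtain ⟨i, hi⟩ := homMk₂_surjective (inv e.homMk₂)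
  obtain ⟨h₁⟩ := (CompStruct.nonempty_iff (f := e) (g := i) (h := .id x)).2 (by simp [hi, homMk₂_id])
  obtain ⟨h₂⟩ := (CompStruct.nonempty_iff (f := i) (g := e) (h := .id y)).2 (by simp [hi, homMk₂_id])
  exact ⟨⟨i, h₁, h₂⟩⟩

lemma Edge.InvStruct.isEquivalence {X : SSet.{u}} {x y : X _⦋0⦌} {e : Edge x y}
    (h : e.InvStruct) : e.IsEquivalence :=
  ⟨⟨Truncated.HomotopyCategory.homMk h.inv.toTruncated,
    (Truncated.HomotopyCategory.homMk_comp_homMk h.homInvId.toTruncated).trans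
      (Truncated.HomotopyCategory.homMk_id _),
    (Truncated.HomotopyCategory.homMk_comp_homMk h.invHomId.toTruncated).trans
      (Truncated.HomotopyCategory.homMk_id _)⟩⟩

/-- Equivalences are defined through the homotopy category presented by generators and relations.
Its functor `F` to the category of homotopy classes of edges preserves isomorphisms, and there an
inverse is represented by an edge with explicit `2`-simplices. -/
lemma Edge.isEquivalence_iff (e : Edge x y) : e.IsEquivalence ↔ Nonempty e.InvStruct := by
  refine ⟨fun h ↦ ?_, fun ⟨h⟩ ↦ h.isEquivalence⟩
  rw [nonempty_invStruct_iff_isIso]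
  let F : ((truncation 2).obj X).HomotopyCategory ⥤
      Truncated.HomotopyCategory₂ ((truncation 2).obj X) :=
    Truncated.HomotopyCategory.lift (fun x ↦ .mk x)
      (fun e ↦ Truncated.HomotopyCategory₂.homMk e) (fun _ ↦ rfl)
      (fun h ↦ h.homotopyCategory₂_fac)
  have : IsIso (F.map (Truncated.HomotopyCategory.homMk e.toTruncated)) := by
    have : IsIso (Truncated.HomotopyCategory.homMk e.toTruncated) := h
    infer_instance
  have h₁ : F.map (Truncated.HomotopyCategory.homMk e.toTruncated) = e.homMk₂ :=
    Truncated.HomotopyCategory.lift_map_homMk ..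
  rwa [h₁] at this

/-- The functor between the homotopy categories induced by a map of `∞`-categories. -/
def hoMap₂ (f : X ⟶ Y) : Truncated.HomotopyCategory₂ ((truncation 2).obj X) ⥤
    Truncated.HomotopyCategory₂ ((truncation 2).obj Y) where
  obj x := .mk (f.app _ x.pt)
  map {x y} := Quotient.map (fun e : Edge (X := X) x.pt y.pt ↦ (e.map f :))
    (fun e₁ e₂ ⟨h⟩ ↦ by
      let c : Edge.CompStruct (X := X) (.ofTruncated e₁) (.id y.pt) (.ofTruncated e₂) := h
      exact ⟨(c.map f).ofEq rfl (congr_arg Edge.edge (Edge.map_id (X := X) y.pt f)) rfl⟩)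
  map_id x := by
    exact congr_arg Edge.homMk₂ (Edge.map_id (X := X) x.pt f)
  map_comp {x y z} g h := by
    obtain ⟨g, rfl⟩ := Edge.homMk₂_surjective (X := X) g
    obtain ⟨h, rfl⟩ := Edge.homMk₂_surjective (X := X) h
    obtain ⟨k, ⟨c⟩⟩ := Edge.exists_comp g h
    rw [c.fac]
    exact (c.map f).fac.symm

end Invertible

/-! ### Invertible `1`-simplices and their reflection along fibrations -/

section IsInvertible

variable {X Y : SSet.{u}}

/-- A `1`-simplex is invertible if it is invertible as an edge. -/
def IsInvertible (s : X _⦋1⦌) : Prop := Nonempty (Edge.mk' s).InvStruct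

lemma Edge.isInvertible_iff {x y : X _⦋0⦌} (e : Edge x y) :
    IsInvertible e.edge ↔ Nonempty e.InvStruct :=
  ⟨fun ⟨h⟩ ↦ ⟨h.ofEq rfl⟩, fun ⟨h⟩ ↦ ⟨h.ofEq rfl⟩⟩

lemma IsInvertible.map {s : X _⦋1⦌} (hs : IsInvertible s) (f : X ⟶ Y) :
    IsInvertible (f.app _ s) := by
  obtain ⟨h⟩ := hs
  exact ((Edge.mk' s).map f).isInvertible_iff.2 ⟨h.map f⟩

lemma IsInvertible.exists_inverse {s : X _⦋1⦌} (hs : IsInvertible s) :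
    ∃ (t : X _⦋1⦌) (a : X _⦋2⦌), IsInvertible t ∧
      X.δ 2 a = s ∧ X.δ 0 a = t ∧ X.δ 1 a = X.σ 0 (X.δ 1 s) := by
  obtain ⟨h⟩ := hs
  exact ⟨h.inv.edge, h.homInvId.simplex, (Edge.isInvertible_iff _).2 ⟨h.invStructInv⟩,
    h.homInvId.d₂, h.homInvId.d₀, h.homInvId.d₁⟩

lemma IsInvertible.exists_inverse' {s : X _⦋1⦌} (hs : IsInvertible s) :
    ∃ (t : X _⦋1⦌) (a : X _⦋2⦌), IsInvertible t ∧
      X.δ 2 a = t ∧ X.δ 0 a = s ∧ X.δ 1 a = X.σ 0 (X.δ 0 s) := by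
  obtain ⟨h⟩ := hs
  exact ⟨h.inv.edge, h.invHomId.simplex, (Edge.isInvertible_iff _).2 ⟨h.invStructInv⟩,
    h.invHomId.d₂, h.invHomId.d₀, h.invHomId.d₁⟩

/-- Here `a` gives a one-sided inverse `t` of `s`, and `b` gives a one-sided inverse of `t` on the
other side. In the homotopy category the latter must equal `s`. -/
lemma isInvertible_of_simplices [Quasicategory X] {s : X _⦋1⦌} (a b : X _⦋2⦌)
    (a₂ : X.δ 2 a = s) (a₁ : X.δ 1 a = X.σ 0 (X.δ 1 s))
    (b₂ : X.δ 2 b = X.δ 0 a) (b₁ : X.δ 1 b = X.σ 0 (X.δ 1 (X.δ 0 a))) :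
    IsInvertible s := by
  obtain ⟨x, y, e, rfl⟩ := Edge.exists_of_simplex s
  have h₁ : X.δ 1 (X.δ 0 a) = y := by
    rw [← e.tgt_eq, ← a₂]
    exact (X.δ_comp_δ_apply (i := 0) (j := 1) (by simp) a).symm
  have h₀ : X.δ 0 (X.δ 0 a) = x := by
    rw [← δ_zero_one_eq, a₁, e.src_eq, δ_zero_σ_zero]
  let e' : Edge y x := .mk (X.δ 0 a) h₁ h₀
  have h₁' : X.δ 1 (X.δ 0 b) = x := by
    rw [← h₀, ← b₂]
    exact (X.δ_comp_δ_apply (i := 0) (j := 1) (by simp) b).symm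
  have h₀' : X.δ 0 (X.δ 0 b) = y := by
    rw [← δ_zero_one_eq, b₁, h₁, δ_zero_σ_zero]
  let e'' : Edge x y := .mk (X.δ 0 b) h₁' h₀'
  have c : e.CompStruct e' (.id x) := .mk a a₂ rfl (by simpa using a₁)
  have c' : e'.CompStruct e'' (.id y) := .mk b b₂ rfl (by simpa [h₁] using b₁)
  rw [Edge.isInvertible_iff, Edge.nonempty_invStruct_iff_isIso]
  have hc := c.fac
  have hc' := c'.fac
  rw [Edge.homMk₂_id] at hc hc'
  have : e.homMk₂ = e''.homMk₂ := by
    rw [← Category.comp_id e.homMk₂, ← hc', reassoc_of% hc]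
  exact ⟨⟨e'.homMk₂, hc, by rw [this, hc']⟩⟩

/-- Lifting a `2`-simplex that exhibits an inverse of the image gives `s` a one-sided inverse, whose
image is again invertible. The construction can therefore be repeated. -/
lemma isInvertible_of_map [Quasicategory X] {f : X ⟶ Y} (hf : FillsHorn f (0 : Fin 3))
    {s : X _⦋1⦌} (hs : IsInvertible (f.app _ s)) : IsInvertible s := by
  have key (s : X _⦋1⦌) (hs : IsInvertible (f.app _ s)) :
      ∃ a : X _⦋2⦌, X.δ 2 a = s ∧ X.δ 1 a = X.σ 0 (X.δ 1 s) ∧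
        IsInvertible (f.app _ (X.δ 0 a)) := by
    obtain ⟨t, a, ht, a₂, a₀, a₁⟩ := hs.exists_inverse
    obtain ⟨x, h₂, h₁, rfl⟩ := hf.two_zero s (X.σ 0 (X.δ 1 s))
      (δ_one_σ_zero _).symm a a₂
      (by rw [a₁, SSet.σ_naturality_apply, SSet.δ_naturality_apply])
    exact ⟨x, h₂, h₁, by rwa [SSet.δ_naturality_apply, a₀]⟩
  obtain ⟨a, a₂, a₁, ha⟩ := key s hs
  obtain ⟨b, b₂, b₁, -⟩ := key _ ha
  exact isInvertible_of_simplices a b a₂ a₁ b₂ b₁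

end IsInvertible

end SSet

namespace SSet
open Opposite

/-! ### Décalage -/

section Dec

/-- The endofunctor `[n] ↦ [n + 1]` of the simplex category which adds a new initial vertex. -/
def addInitial : SimplexCategory ⥤ SimplexCategory where
  obj n := ⦋n.len + 1⦌
  map {n m} f := SimplexCategory.Hom.mk
    { toFun := Fin.cases 0 (fun i ↦ (f.toOrderHom i).succ)
      monotone' i j hij := by
        cases i using Fin.cases with
        | zero => simp
        | succ i =>
          cases j using Fin.cases with
          | zero => simp at hij
          | succ j => simpa using f.toOrderHom.monotone (by simpa using hij) }
  map_id n := by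
    ext i : 3
    cases i using Fin.cases <;> rfl
  map_comp f g := by
    ext i : 3
    cases i using Fin.cases <;> rfl

/-- The inclusion of `[n]` in `[n + 1]` that avoids the new initial vertex. -/
def toAddInitial : 𝟭 SimplexCategory ⟶ addInitial where
  app n := SimplexCategory.Hom.mk (Fin.succOrderEmb _).toOrderHom
  naturality n m f := by
    ext i : 3
    rfl

lemma addInitial_map_δ {n : ℕ} (j : Fin (n + 2)) :
    addInitial.map (SimplexCategory.δ j) = SimplexCategory.δ j.succ := by
  ext i : 3
  cases i using Fin.cases with
  | zero => exact (Fin.succ_succAbove_zero j).symm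
  | succ i => exact (Fin.succ_succAbove_succ j i).symm

lemma toAddInitial_app (n : ℕ) : toAddInitial.app ⦋n⦌ = SimplexCategory.δ 0 := by
  ext i : 3
  exact (Fin.succAbove_zero_apply i).symm

/-- The décalage of a simplicial set: its `n`-simplices are the `(n + 1)`-simplices of `X`. -/
def Dec (X : SSet.{u}) : SSet.{u} := addInitial.op ⋙ X

variable {X Y : SSet.{u}}

/-- The functoriality of the décalage. -/
def Dec.map (p : X ⟶ Y) : Dec X ⟶ Dec Y := Functor.whiskerLeft addInitial.op p

/-- The projection `Dec X ⟶ X` which forgets the initial vertex. -/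
def Dec.forget (X : SSet.{u}) : Dec X ⟶ X := Functor.whiskerRight (NatTrans.op toAddInitial) X

lemma Dec.δ_apply {n : ℕ} (j : Fin (n + 2)) (x : (Dec X) _⦋n + 1⦌) :
    (Dec X).δ j x = X.δ (n := n + 1) j.succ x := by
  change X.map (addInitial.map (SimplexCategory.δ j)).op x = _
  rw [addInitial_map_δ]
  rfl

lemma Dec.forget_apply {n : ℕ} (x : (Dec X) _⦋n⦌) :
    (Dec.forget X).app _ x = X.δ (n := n) 0 x := by
  change X.map (toAddInitial.app ⦋n⦌).op x = _
  rw [toAddInitial_app]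
  rfl

/-- A horn in `Dec X` together with a filler `ξ` of its image in `X` is a horn of `X` one dimension
higher: `ξ` is the face opposite the new initial vertex. -/
lemma HornCompatible.cons {n : ℕ} {i : Fin (n + 3)} {y : Fin (n + 3) → X _⦋n + 2⦌}
    (hy : HornCompatible (X := Dec X) i y) (ξ : X _⦋n + 2⦌)
    (hξ : ∀ j, j ≠ i → X.δ j ξ = X.δ 0 (y j)) :
    HornCompatible (X := X) i.succ (Fin.cons ξ y : Fin (n + 4) → X _⦋n + 2⦌) := by
  intro j k hj hk hjk
  obtain ⟨k, rfl⟩ := Fin.eq_succ_of_ne_zero (Fin.ne_zero_of_lt hjk)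
  cases j using Fin.cases with
  | zero => exact hξ k (by simpa using hk)
  | succ j =>
    have hjk' : j < k := by simpa using hjk
    have h := hy j k (by simpa using hj) (by simpa using hk) hjk'
    replace h := ((Dec.δ_apply _ _).symm.trans h).trans (Dec.δ_apply _ _)
    have h₁ : k.succ.pred (Fin.ne_zero_of_lt hjk) = (k.pred (Fin.ne_zero_of_lt hjk')).succ := by
      rw [Fin.pred_succ, Fin.succ_pred]
    have h₂ : j.succ.castPred (Fin.ne_last_of_lt hjk) =
        (j.castPred (Fin.ne_last_of_lt hjk')).succ := rfl
    rw [h₁, h₂]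
    exact h

/-- For `p : X ⟶ Y`, the fibre product of `Dec Y` and `X` over `Y`. -/
def decPullback (p : X ⟶ Y) : (Dec Y ⊗ X).Subcomplex where
  obj n := {z | (Dec.forget Y).app n z.1 = p.app n z.2}
  map {n m} f z hz := by
    have h₁ := NatTrans.naturality_apply (Dec.forget Y) f z.1
    have h₂ := NatTrans.naturality_apply p f z.2
    change (Dec.forget Y).app m ((Dec Y).map f z.1) = p.app m (X.map f z.2)
    rw [h₁, h₂, show (Dec.forget Y).app n z.1 = p.app n z.2 from hz]

/-- The map `Dec X ⟶ Dec Y ×_Y X` induced by `p : X ⟶ Y`. -/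
def toDecPullback (p : X ⟶ Y) : Dec X ⟶ (decPullback p : SSet.{u}) :=
  Subcomplex.lift (CartesianMonoidalCategory.lift (Dec.map p) (Dec.forget X)) (by
    rintro n _ ⟨x, rfl⟩
    exact (NatTrans.naturality_apply p (toAddInitial.app n.unop).op x).symm)

/-- The projection `Dec Y ×_Y X ⟶ X`. -/
def decPullbackSnd (p : X ⟶ Y) : (decPullback p : SSet.{u}) ⟶ X :=
  (decPullback p).ι ≫ SemiCartesianMonoidalCategory.snd _ _

/-- The `Dec Y` component of the base simplex is the simplex of `Y` to be lifted, and its `X`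
component is the extra face `0`. An index `i < last` gives an inner `i.succ`, so inner fibrations
become left fibrations. -/
lemma fillsHorn_toDecPullback {p : X ⟶ Y} {n : ℕ} {i : Fin (n + 3)} (hp : FillsHorn p i.succ) :
    FillsHorn (toDecPullback p) i := by
  rintro y hy ⟨⟨η, ξ⟩, hη₀⟩ hη
  have hη₁ (j) (hj : j ≠ i) : (Dec Y).δ j η = (Dec.map p).app _ (y j) :=
    congr_arg (fun z ↦ z.1.1) (hη j hj)
  have hη₂ (j) (hj : j ≠ i) : X.δ j ξ = (Dec.forget X).app _ (y j) :=
    congr_arg (fun z ↦ z.1.2) (hη j hj)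
  obtain ⟨x, h₁, h₂⟩ := hp _ (HornCompatible.cons hy ξ
    (fun j hj ↦ (hη₂ j hj).trans (Dec.forget_apply _))) η (fun j hj ↦ by
      cases j using Fin.cases with
      | zero => exact (Dec.forget_apply _).symm.trans hη₀
      | succ j => exact (Dec.δ_apply _ _).symm.trans (hη₁ j (by simpa using hj)))
  refine ⟨x, fun j hj ↦ (Dec.δ_apply _ _).trans (h₁ j.succ (by simpa using hj)), ?_⟩
  apply Subtype.ext
  refine Prod.ext h₂ ((Dec.forget_apply _).trans (h₁ 0 (Fin.succ_ne_zero i).symm))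

lemma fillsHorn_decForget [Quasicategory X] {n : ℕ} {i : Fin (n + 3)} (hi : i < Fin.last _) :
    FillsHorn (Dec.forget X) i := by
  intro y hy η hη
  obtain ⟨x, hx⟩ := Quasicategory.exists_filler i.succ (by simp)
    (by rwa [← Fin.succ_last, Fin.succ_lt_succ_iff]) _
    (HornCompatible.cons hy η (fun j hj ↦ (hη j hj).trans (Dec.forget_apply _)))
  exact ⟨x, fun j hj ↦ (Dec.δ_apply _ _).trans (hx j.succ (by simpa using hj)),
    (Dec.forget_apply _).trans (hx 0 (Fin.succ_ne_zero i).symm)⟩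

/-- This projection is the base change along `p` of the left fibration `Dec Y ⟶ Y`. -/
lemma fillsHorn_decPullbackSnd [Quasicategory Y] (p : X ⟶ Y) {n : ℕ} {i : Fin (n + 3)}
    (hi : i < Fin.last _) : FillsHorn (decPullbackSnd p) i := by
  intro y hy η hη
  obtain ⟨z, h₁, h₂⟩ := fillsHorn_decForget (X := Y) hi (fun j ↦ (y j).1.1)
    (fun j k hj hk hjk ↦ congr_arg (fun z ↦ z.1.1) (hy j k hj hk hjk)) (p.app _ η)
    (fun j hj ↦ (SSet.δ_naturality_apply p j η).symm.trans
      ((congr_arg _ (hη j hj)).trans (y j).2.symm))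
  exact ⟨⟨⟨z, η⟩, h₂⟩, fun j hj ↦ Subtype.ext (Prod.ext (h₁ j hj) (hη j hj)), rfl⟩

lemma quasicategory_of_fillsHorn [Quasicategory Y] {p : X ⟶ Y}
    (hp : ∀ (n : ℕ) (i : Fin (n + 3)), i < Fin.last _ → FillsHorn p i) : Quasicategory X :=
  have : InnerFibration p := ⟨(innerFibrations_iff_fillsHorn p).2 (fun n i _ h ↦ hp n i h)⟩
  quasicategory_of_innerFibration p

instance [Quasicategory X] : Quasicategory (Dec X) :=
  quasicategory_of_fillsHorn (p := Dec.forget X) (fun _ _ h ↦ fillsHorn_decForget h)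

lemma quasicategory_decPullback [Quasicategory X] [Quasicategory Y] (p : X ⟶ Y) :
    Quasicategory (decPullback p : SSet.{u}) :=
  quasicategory_of_fillsHorn (p := decPullbackSnd p) (fun _ _ h ↦ fillsHorn_decPullbackSnd p h)

end Dec
-- Joyal's lifting theorem for last horns
section LastEdge

/-- The edge of an `(n + 1)`-simplex between its last two vertices. -/
def lastEdge {X : SSet.{u}} (n : ℕ) (x : X _⦋n + 1⦌) : X _⦋1⦌ :=
  match n with
  | 0 => x
  | n + 1 => lastEdge n (X.δ 0 x)

lemma lastEdge_naturality {X Y : SSet.{u}} (f : X ⟶ Y) (n : ℕ) (x : X _⦋n + 1⦌) :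
    f.app (op ⦋1⦌) (lastEdge n x) = lastEdge n (f.app (op ⦋n + 1⦌) x) := by
  induction n with
  | zero => rfl
  | succ n ih =>
    dsimp only [lastEdge]
    rw [ih, SSet.δ_naturality_apply]

/-- An inner fibration of `∞`-categories has the right lifting property with respect to
`Λ[2, 2]`, provided that the edge from `1` to `2` is invertible. -/
lemma exists_lift_horn_two_two {X Y : SSet.{u}} [Quasicategory X] [Quasicategory Y]
    {p : X ⟶ Y} (hp : innerFibrations p) (b c : X _⦋1⦌) (hbc : X.δ 0 b = X.δ 0 c)
    (hb : IsInvertible b) (η : Y _⦋2⦌) (h₀ : Y.δ 0 η = p.app _ b) (h₁ : Y.δ 1 η = p.app _ c) :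
    ∃ x : X _⦋2⦌, X.δ 0 x = b ∧ X.δ 1 x = c ∧ p.app _ x = η := by
  rw [innerFibrations_iff_fillsHorn] at hp
  have := quasicategory_decPullback p
  let V : SSet.{u} := decPullback p
  let q : Dec X ⟶ V := toDecPullback p
  let e : V _⦋1⦌ := ⟨(η, b), (Dec.forget_apply _).trans h₀⟩
  have he : IsInvertible e :=
    isInvertible_of_map (f := decPullbackSnd p) (fillsHorn_decPullbackSnd p (by decide)) hb
  -- A lift of `e` with prescribed target `c` is sought, whereas `q` lifts edges from a prescribed
  -- source. So an inverse `t` of `e` is lifted first, starting at `c`.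
  obtain ⟨t, a, -, a₂, a₀, a₁⟩ := he.exists_inverse'
  have het : V.δ 1 t = V.δ 0 e := by
    rw [← a₂, ← δ_one_one_eq, a₁, δ_one_σ_zero]
  have het₁ : Y.δ 2 (show Y _⦋2⦌ from t.1.1) = Y.δ 1 η :=
    (Dec.δ_apply 1 t.1.1).symm.trans ((congr_arg (fun z ↦ z.1.1) het).trans (Dec.δ_apply 0 _))
  have het₂ : X.δ 1 t.1.2 = X.δ 0 b := congr_arg (fun z ↦ z.1.2) het
  obtain ⟨x', h₂', h₀', hx'⟩ := FillsHorn.two_one (hp 0 1 (by decide) (by decide)) c t.1.2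
    (by rw [het₂, hbc]) t.1.1 (by rw [het₁, h₁]) ((Dec.forget_apply _).symm.trans t.2)
  have hqx' : q.app (op ⦋1⦌) (x' : (Dec X) _⦋1⦌) = t :=
    Subtype.ext (Prod.ext hx' ((Dec.forget_apply _).trans h₀'))
  let c' : (Dec X) _⦋0⦌ := c
  have hqc' : q.app (op ⦋0⦌) c' = V.δ 0 e :=
    Subtype.ext (Prod.ext (h₁.symm.trans (Dec.δ_apply (X := Y) 0 _).symm)
      ((Dec.forget_apply (X := X) _).trans hbc.symm))
  -- Next the triangle `a`, in which `t` followed by `e` is degenerate, is lifted along `Λ[2, 0]`,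
  -- an inner horn `Λ[3, 1]` for `p`. Its face `0` lies over `e` and ends at `c`.
  obtain ⟨w, w₂, w₁, hw⟩ := FillsHorn.two_zero
    (fillsHorn_toDecPullback (p := p) (n := 0) (i := 0) (hp 1 1 (by decide) (by decide)))
    (x' : (Dec X) _⦋1⦌) ((Dec X).σ 0 c')
    (((Dec.δ_apply (X := X) 1 _).trans h₂').trans (δ_one_σ_zero c').symm) a
    (a₂.trans hqx'.symm) (by
      rw [a₁, ← hqc']
      exact (SSet.σ_naturality_apply q 0 c').symm)
  have hqw : q.app _ ((Dec X).δ 0 w) = e :=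
    (SSet.δ_naturality_apply q 0 w).trans ((congr_arg _ hw).trans a₀)
  refine ⟨(Dec X).δ 0 w, ?_, ?_, ?_⟩
  · exact (Dec.forget_apply (X := X) _).symm.trans (congr_arg (fun z ↦ z.1.2) hqw)
  · refine (Dec.δ_apply (X := X) 0 _).symm.trans ?_
    rw [← δ_zero_one_eq, w₁, δ_zero_σ_zero]
  · exact congr_arg (fun z ↦ z.1.1) hqw

lemma HornCompatible.tail {X : SSet.{u}} {n : ℕ} {i : Fin (n + 3)}
    {y : Fin (n + 4) → X _⦋n + 2⦌} (hy : HornCompatible i.succ y) :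
    HornCompatible (X := Dec X) i (fun j ↦ y j.succ) := by
  intro j k hj hk hjk
  have h := hy j.succ k.succ (by simpa using hj) (by simpa using hk) (by simpa using hjk)
  refine (Dec.δ_apply _ _).trans (Eq.trans ?_ (Dec.δ_apply _ _).symm)
  rw [Fin.succ_pred]
  exact h

/-- An inner fibration of `∞`-categories has the right lifting property with respect to
the last horn `Λ[n + 2, n + 2]`, provided that the last edge is invertible. -/
theorem exists_lift_last_horn (n : ℕ) : ∀ {X Y : SSet.{u}} [Quasicategory X] [Quasicategory Y]
    {p : X ⟶ Y} (_ : innerFibrations p) (y : Fin (n + 3) → X _⦋n + 1⦌)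
    (_ : HornCompatible (Fin.last _) y) (_ : IsInvertible (lastEdge n (y 0))) (η : Y _⦋n + 2⦌)
    (_ : ∀ j, j ≠ Fin.last _ → Y.δ j η = p.app _ (y j)),
      ∃ x : X _⦋n + 2⦌, (∀ j, j ≠ Fin.last _ → X.δ j x = y j) ∧ p.app _ x = η := by
  induction n with
  | zero =>
    intro X Y _ _ p hp y hy hy₀ η hη
    obtain ⟨x, h₀, h₁, hx⟩ := exists_lift_horn_two_two hp (y 0) (y 1)
      (hy 0 1 (by simp) (by decide) (by simp)) hy₀ η (hη 0 (by simp)) (hη 1 (by decide))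
    refine ⟨x, fun j hj ↦ ?_, hx⟩
    fin_cases j
    · exact h₀
    · exact h₁
    · exact (hj rfl).elim
  | succ n ih =>
    intro X Y _ _ p hp y hy hy₀ η hη
    have hp' := (innerFibrations_iff_fillsHorn p).1 hp
    have := quasicategory_decPullback p
    have h₁₀ : X.δ 0 (y 0) = X.δ 0 (y 1) :=
      hy 0 1 (by simp [Fin.ext_iff]) (by simp [Fin.ext_iff]) (by simp)
    have hη₀ := hη 0 (by simp [Fin.ext_iff])
    -- Décalage lowers the dimension by one: the face `y 0` becomes part of the base simplex and the
    -- other faces form a last horn in `Dec X`.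
    obtain ⟨x, h₁, h₂⟩ := ih (X := Dec X) (Y := decPullback p) (p := toDecPullback p)
      ((innerFibrations_iff_fillsHorn _).2 (fun m i h₀ h₁ ↦
        fillsHorn_toDecPullback (hp' _ _ (by simp)
          (by rwa [← Fin.succ_last, Fin.succ_lt_succ_iff]))))
      (fun j ↦ y j.succ) (HornCompatible.tail (i := Fin.last _) hy) (by
        -- The last edge of `y 1`, taken in `Dec X`, lies over the last edge of `y 0`, and `Dec X ⟶
        -- X` reflects invertibility.
        apply isInvertible_of_map (f := Dec.forget X) (fillsHorn_decForget (by decide))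
        dsimp only [lastEdge] at hy₀
        rw [h₁₀] at hy₀
        exact ((lastEdge_naturality (Dec.forget X) n _).trans
          (congr_arg (lastEdge n) (Dec.forget_apply (X := X) _))) ▸ hy₀) ⟨(η, y 0), (Dec.forget_apply _).trans hη₀⟩
      (fun j hj ↦ by
        have hj' : j.succ ≠ Fin.last _ := by rwa [← Fin.succ_last, Ne, Fin.succ_inj]
        refine Subtype.ext (Prod.ext ((Dec.δ_apply (X := Y) _ _).trans (hη _ hj')) ?_)
        refine Eq.trans ?_ (Dec.forget_apply (X := X) _).symm
        exact (hy 0 j.succ (by simp [Fin.ext_iff]) hj' (by simp)))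
    refine ⟨x, fun j hj ↦ ?_, congr_arg (fun z ↦ z.1.1) h₂⟩
    cases j using Fin.cases with
    | zero => exact (Dec.forget_apply (X := X) _).symm.trans (congr_arg (fun z ↦ z.1.2) h₂)
    | succ j =>
      exact (Dec.δ_apply (X := X) _ _).symm.trans
        (h₁ j (by rwa [← Fin.succ_last, Ne, Fin.succ_inj] at hj))

end LastEdge

end SSet

namespace SSet
open Opposite

/-! ### Extending lifts along an attached simplex -/

section AttachSimplex

variable {P D X Y : SSet.{u}}

/-- Extending a lift along `A ⊔ range σ`, where `σ` is a monomorphism. -/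
lemma Subcomplex.exists_lift_sup_range {p : X ⟶ Y} (A : P.Subcomplex) (σ : D ⟶ P) [Mono σ]
    (f : (A : SSet.{u}) ⟶ X) (g : P ⟶ Y) (hf : f ≫ p = A.ι ≫ g) (l : D ⟶ X)
    (hl : (A.preimage σ).ι ≫ l = A.fromPreimage σ ≫ f) (hlp : l ≫ p = σ ≫ g) :
    ∃ f' : ((A ⊔ Subcomplex.range σ : P.Subcomplex) : SSet.{u}) ⟶ X,
      Subcomplex.homOfLE le_sup_left ≫ f' = f ∧ f' ≫ p = (A ⊔ Subcomplex.range σ).ι ≫ g := by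
  have sq : Subcomplex.BicartSq (A ⊓ Subcomplex.range σ) A (Subcomplex.range σ)
    (A ⊔ Subcomplex.range σ) := ⟨rfl, rfl⟩
  have hl' : l = Subcomplex.toRange σ ≫ inv (Subcomplex.toRange σ) ≫ l := by simp
  have w : Subcomplex.homOfLE sq.le₁₂ ≫ f =
      Subcomplex.homOfLE sq.le₁₃ ≫ inv (Subcomplex.toRange σ) ≫ l := by
    ext m ⟨_, hx, s, rfl⟩
    have h₁ := ConcreteCategory.congr_hom (NatTrans.congr_app hl m) ⟨s, hx⟩
    have h₂ := ConcreteCategory.congr_hom (NatTrans.congr_app hl' m) s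
    exact h₁.symm.trans h₂
  refine ⟨sq.isPushout.desc f (inv (Subcomplex.toRange σ) ≫ l) w,
    sq.isPushout.inl_desc _ _ _, sq.isPushout.hom_ext ?_ ?_⟩
  · rw [sq.isPushout.inl_desc_assoc, hf]
    rfl
  · rw [sq.isPushout.inr_desc_assoc, Category.assoc, hlp, IsIso.inv_comp_eq]
    rfl

end AttachSimplex

/-! ### The filtration of the prism -/

section Prism

lemma lastEdge_eq_map {X : SSet.{u}} (n : ℕ) (x : X _⦋n + 1⦌) :
    lastEdge n x = X.map (SimplexCategory.δ₀Iter n (by lia)).op x := by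
  induction n with
  | zero => exact (ConcreteCategory.congr_hom (X.map_id (op ⦋1⦌)) x).symm
  | succ n ih =>
    rw [SimplexCategory.δ₀Iter_succ n, op_comp, Functor.map_comp_apply]
    exact ih _

/-- The union of `∂Δ[n] ⊗ Δ[1]` and of the simplices of `Δ[n] ⊗ Δ[1]` all of whose vertices
over `0` have their first coordinate smaller than `k`. -/
def prismFiltration (n k : ℕ) : (Δ[n] ⊗ Δ[1] : SSet.{u}).Subcomplex where
  obj m := {z | (∃ v, ∀ t, stdSimplex.asOrderHom z.1 t ≠ v) ∨
    ∀ t, stdSimplex.asOrderHom z.2 t = 0 → (stdSimplex.asOrderHom z.1 t).val < k}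
  map {m m'} f z hz := by
    obtain ⟨v, hv⟩ | hz := hz
    · exact Or.inl ⟨v, fun t ↦ hv _⟩
    · exact Or.inr fun t ht ↦ hz _ ht

lemma mem_prismFiltration_iff (n k : ℕ) {d : ℕ} (z : (Δ[n] ⊗ Δ[1] : SSet.{u}) _⦋d⦌) :
    z ∈ (prismFiltration n k).obj (op ⦋d⦌) ↔
      (∃ v, ∀ t, z.1 t ≠ v) ∨ ∀ t, z.2 t = 0 → (z.1 t).val < k := Iff.rfl

lemma prismFiltration_eq_top (n : ℕ) : prismFiltration.{u} n (n + 1) = ⊤ := by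
  ext ⟨⟨d⟩⟩ z
  refine ⟨fun _ ↦ trivial, fun _ ↦ Or.inr fun t _ ↦ (stdSimplex.asOrderHom z.1 t).isLt⟩

/-- The nondegenerate `(n + 1)`-simplices of the prism `Δ[n] ⊗ Δ[1]`. -/
noncomputable def prismSimplex (n : ℕ) (i : Fin (n + 1)) :
    Δ[n + 1] ⟶ (Δ[n] ⊗ Δ[1] : SSet.{u}) :=
  yonedaEquiv.symm (prodStdSimplex.nonDegenerateEquiv₁ i).1

lemma prismSimplex_fst {n : ℕ} (i : Fin (n + 1)) {d : ℕ} (s : (Δ[n + 1] : SSet.{u}) _⦋d⦌)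
    (t : Fin (d + 1)) :
    ((show (Δ[n] : SSet.{u}) _⦋d⦌ from ((prismSimplex n i).app (op ⦋d⦌) s).1) t).val =
      if (s t).val ≤ i.val then (s t).val else (s t).val - 1 := by
  change (i.predAbove (s t)).val = _
  simp only [Fin.predAbove, Fin.lt_def, Fin.val_castSucc]
  split_ifs with h₁ h₂ <;> simp at * <;> lia

lemma prismSimplex_snd_eq_zero_iff {n : ℕ} (i : Fin (n + 1)) {d : ℕ}
    (s : (Δ[n + 1] : SSet.{u}) _⦋d⦌) (t : Fin (d + 1)) :
    (show (Δ[1] : SSet.{u}) _⦋d⦌ from ((prismSimplex n i).app (op ⦋d⦌) s).2) t = 0 ↔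
      (s t).val ≤ i.val := by
  change (if (s t).castSucc < i.succ.castSucc then (0 : Fin 2) else 1) = 0 ↔ _
  simp [Fin.lt_def]

lemma mem_range_prismSimplex_iff {n : ℕ} (i : Fin (n + 1)) {d : ℕ}
    (z : (Δ[n] ⊗ Δ[1] : SSet.{u}) _⦋d⦌) :
    z ∈ (Subcomplex.range (prismSimplex n i)).obj (op ⦋d⦌) ↔
      ∀ t, (z.2 t = 0 → (z.1 t).val ≤ i.val) ∧ (z.2 t ≠ 0 → i.val ≤ (z.1 t).val) := by
  constructor
  · rintro ⟨s, rfl⟩ t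
    have h₁ := prismSimplex_fst i s t
    have h₂ := prismSimplex_snd_eq_zero_iff i s t
    dsimp only at h₁ h₂
    erw [Ne, h₂, h₁]
    split_ifs <;> lia
  · intro hz
    obtain ⟨z₁, z₂⟩ := z
    have key (t) : (prodStdSimplex.orderHomOfSimplex (z₁, z₂) rfl t).val =
      (z₁ t).val + (z₂ t).val := rfl
    refine ⟨stdSimplex.objMk (prodStdSimplex.orderHomOfSimplex (z₁, z₂) rfl),
      Prod.ext (stdSimplex.ext _ _ fun t ↦ ?_) (stdSimplex.ext _ _ fun t ↦ ?_)⟩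
    · rw [Fin.ext_iff]
      refine (prismSimplex_fst i _ t).trans ?_
      have := hz t
      change (if (z₁ t).val + (z₂ t).val ≤ i.val then (z₁ t).val + (z₂ t).val else
        (z₁ t).val + (z₂ t).val - 1) = _
      dsimp only at this
      have hc : z₂ t = 0 ↔ (z₂ t).val = 0 := Fin.ext_iff
      have := (z₂ t).isLt
      split_ifs <;> lia
    · have h₁ := prismSimplex_snd_eq_zero_iff i
        (stdSimplex.objMk (prodStdSimplex.orderHomOfSimplex (z₁, z₂) rfl)) t
      change _ ↔ (z₁ t).val + (z₂ t).val ≤ i.val at h₁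
      have := hz t
      dsimp only at this h₁ ⊢
      generalize DFunLike.coe (F := (Δ[1] : SSet.{u}) _⦋d⦌) _ t = w at h₁ ⊢
      rw [Fin.ext_iff] at h₁ ⊢
      have hc : z₂ t = 0 ↔ (z₂ t).val = 0 := Fin.ext_iff
      have := (z₂ t).isLt
      have := w.isLt
      simp only [Fin.val_zero] at h₁
      lia

instance (n : ℕ) (i : Fin (n + 1)) : Mono (prismSimplex.{u} n i) := by
  rw [NatTrans.mono_iff_mono_app]
  rintro ⟨⟨d⟩⟩
  rw [mono_iff_injective]
  intro (s : (Δ[n + 1] : SSet.{u}) _⦋d⦌) (s' : (Δ[n + 1] : SSet.{u}) _⦋d⦌) h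
  apply stdSimplex.ext
  intro t
  have h₁ := (prismSimplex_fst i s t).symm.trans
    ((congr_arg (fun z ↦ (stdSimplex.asOrderHom z.1 t).val) h).trans (prismSimplex_fst i s' t))
  have h₂ := (prismSimplex_snd_eq_zero_iff i s t).symm.trans
    ((iff_of_eq (congr_arg (fun z ↦ stdSimplex.asOrderHom z.2 t = 0) h)).trans
      (prismSimplex_snd_eq_zero_iff i s' t))
  rw [Fin.ext_iff]
  split_ifs at h₁ <;> lia

/-- By monotonicity, if a vertex over `0` has first coordinate at least `i`, every vertex over `1`
comes later and also has first coordinate at least `i`. -/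
lemma prismFiltration_succ (n : ℕ) (i : Fin (n + 1)) :
    prismFiltration.{u} n (i + 1) =
      prismFiltration n i ⊔ Subcomplex.range (prismSimplex n i) := by
  ext ⟨⟨d⟩⟩ z
  refine Iff.trans (mem_prismFiltration_iff _ _ z) (Iff.trans ?_ (or_congr
    (mem_prismFiltration_iff _ _ z).symm (mem_range_prismSimplex_iff i z).symm))
  constructor
  · intro h
    by_contra! h'
    obtain ⟨⟨h₁, t₀, h₂, h₃⟩, t₁, h₄⟩ := h'
    obtain ⟨v, hv⟩ | h := h
    · obtain ⟨t, ht⟩ := h₁ v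
      exact hv t ht
    · have h₅ := h₄ fun h₅ ↦ Nat.le_of_lt_succ (h t₁ h₅)
      have h₆ : t₁ ≤ t₀ := by
        by_contra! h₆
        have := stdSimplex.monotone_apply z.1 h₆.le
        simp only [Fin.le_def] at this
        lia
      have := stdSimplex.monotone_apply z.2 h₆
      dsimp only at this
      rw [h₂, Fin.le_zero_iff] at this
      exact h₅.1 this
  · rintro ((h | h) | h)
    · exact Or.inl h
    · exact Or.inr fun t ht ↦ (h t ht).trans (Nat.lt_succ_self _)
    · exact Or.inr fun t ht ↦ Nat.lt_succ_of_le ((h t).1 ht)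

/-- The vertices of the simplex are `(0,0), …, (i,0), (i,1), …, (n,1)`. Omitting `(i,0)` leaves only
first coordinates below `i` over `0`; omitting a vertex other than `(i,0)` and `(i,1)` loses a value
of the first coordinate. Only the face omitting `(i,1)` is new. The horn is never the zeroth one,
and is the last one only for `i = n`. -/
lemma preimage_prismFiltration (n : ℕ) (i : Fin (n + 1)) :
    (prismFiltration.{u} n i).preimage (prismSimplex n i) = Λ[n + 1, i.succ] := by
  ext ⟨⟨d⟩⟩ (s : (Δ[n + 1] : SSet.{u}) _⦋d⦌)
  refine Iff.trans (mem_prismFiltration_iff _ _ ((prismSimplex n i).app (op ⦋d⦌) s)) ?_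
  refine Iff.trans ?_ (mem_horn_iff_notMem_range s i.succ).symm
  have h₁ := prismSimplex_fst i s
  have h₂ := prismSimplex_snd_eq_zero_iff i s
  constructor
  · rintro (⟨v, hv⟩ | h)
    · have hv' (t) := mt Fin.ext_iff.2 (hv t)
      refine ⟨⟨if v.val ≤ i.val then v.val else v.val + 1, by split_ifs <;> lia⟩, ?_, ?_⟩
      · rw [Ne, Fin.ext_iff, Fin.val_succ]
        dsimp only
        split_ifs <;> lia
      · rintro ⟨t, ht⟩
        rw [Fin.ext_iff] at ht
        refine hv' t ((h₁ t).trans ?_)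
        rw [ht]
        split_ifs <;> lia
    · refine ⟨i.castSucc, Fin.castSucc_lt_succ.ne, ?_⟩
      rintro ⟨t, ht⟩
      have := h t ((h₂ t).2 (by rw [ht]; simp))
      have h₁ := (h₁ t).symm.trans_lt this
      rw [ht] at h₁
      simp at h₁
  · rintro ⟨j, hj, hs⟩
    have hj' := mt Fin.ext_iff.2 hj
    rw [Fin.val_succ] at hj'
    have hs' (t) : (s t).val ≠ j.val := fun ht ↦ hs ⟨t, Fin.ext ht⟩
    by_cases hij : j.val = i.val
    · refine Or.inr fun t ht ↦ (h₁ t).trans_lt ?_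
      have := (h₂ t).1 ht
      have := hs' t
      split_ifs
      lia
    · refine Or.inl ⟨⟨if j.val ≤ i.val then j.val else j.val - 1, by split_ifs <;> lia⟩,
        fun t ht ↦ hs' t ?_⟩
      have := (h₁ t).symm.trans (Fin.ext_iff.1 ht)
      dsimp only at this
      split_ifs at this <;> lia

end Prism

/-! ### Lifting over the prism -/

section BoxLifting

variable {X Y : SSet.{u}} [Quasicategory X] [Quasicategory Y] {p : X ⟶ Y}

/-- An inner fibration of `∞`-categories has the right lifting property with respect to
the last horn inclusion for those horns whose last edge is invertible. -/
lemma exists_lift_of_last_horn (hp : innerFibrations p) {n : ℕ}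
    (f : (Λ[n + 2, Fin.last _] : SSet.{u}) ⟶ X) (g : Δ[n + 2] ⟶ Y)
    (w : f ≫ p = Λ[n + 2, Fin.last _].ι ≫ g)
    (hf : IsInvertible (f.app _ (lastEdge n (horn.face (Fin.last (n + 2)) 0 (by simp [Fin.ext_iff]))))) :
    ∃ l : Δ[n + 2] ⟶ X, Λ[n + 2, Fin.last _].ι ≫ l = f ∧ l ≫ p = g := by
  obtain ⟨y, hy⟩ := exists_faces_of_hom f
  obtain ⟨x, h₁, h₂⟩ := exists_lift_last_horn n hp y (hornCompatible_of_hom f hy) (by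
    rw [lastEdge_naturality, ← horn.yonedaEquiv_ι, ← yonedaEquiv_comp, ← hy] at hf
    exact hf) (yonedaEquiv g) (fun j hj ↦ by
      rw [hy j hj, ← stdSimplex.yonedaEquiv_δ_comp, ← yonedaEquiv_comp, Category.assoc, w,
        horn.ι_ι_assoc])
  exact FillsHorn.exists_lift ⟨x, fun j hj ↦ (h₁ j hj).trans (hy j hj), h₂⟩

/-- The horn enters as a variable `B` because it arises as a preimage in the filtration;
invertibility is needed only for the last horn. -/
lemma exists_lift_of_inner_or_last_horn (hp : innerFibrations p) {n : ℕ} (i : Fin (n + 2))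
    {B : (Δ[n + 2] : SSet.{u}).Subcomplex} (hB : B = Λ[n + 2, i.succ]) (f : (B : SSet.{u}) ⟶ X)
    (g : Δ[n + 2] ⟶ Y) (w : f ≫ p = B.ι ≫ g)
    (hf : ∀ e : (B : SSet.{u}) _⦋1⦌, i = Fin.last _ →
      e.1 = lastEdge n (stdSimplex.objEquiv.symm (SimplexCategory.δ 0)) →
        IsInvertible (f.app _ e)) :
    ∃ l : Δ[n + 2] ⟶ X, B.ι ≫ l = f ∧ l ≫ p = g := by
  subst hB
  obtain hi | rfl := i.le_last.lt_or_eq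
  · have := hp _ (horn_ι_mem_innerHornInclusions (i := i.succ) (by simp)
      (by rwa [← Fin.succ_last, Fin.succ_lt_succ_iff]))
    have sq : CommSq f Λ[n + 2, i.succ].ι p g := ⟨w⟩
    exact ⟨sq.lift, sq.fac_left, sq.fac_right⟩
  · exact exists_lift_of_last_horn hp f g w (hf _ rfl (lastEdge_naturality (Subcomplex.ι _) n _))

/-- The edge `{n} ⊗ Δ[1]` of the prism `Δ[n] ⊗ Δ[1]`. -/
def prismLastEdge (n : ℕ) : (Δ[n] ⊗ Δ[1] : SSet.{u}) _⦋1⦌ :=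
  ⟨stdSimplex.const n (Fin.last n) _, stdSimplex.objEquiv.symm (𝟙 _)⟩

lemma prismLastEdge_mem (n k : ℕ) :
    prismLastEdge.{u} (n + 1) ∈ (prismFiltration (n + 1) k).obj _ :=
  Or.inl ⟨0, fun _ ↦ (Fin.last_pos (n := n)).ne'⟩

lemma lastEdge_prismSimplex (n : ℕ) :
    lastEdge n ((prismSimplex.{u} (n + 1) (Fin.last _)).app _
      (stdSimplex.objEquiv.symm (SimplexCategory.δ 0))) = prismLastEdge (n + 1) := by
  rw [lastEdge_eq_map]
  let s : (Δ[n + 2] : SSet.{u}) _⦋n + 1⦌ := stdSimplex.objEquiv.symm (SimplexCategory.δ 0)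
  have hs (t : Fin 2) : (s ⟨t + n, by lia⟩).val = t + n + 1 :=
    congr_arg Fin.val (Fin.succAbove_zero_apply (⟨t + n, by lia⟩ : Fin (n + 2)))
  refine Prod.ext (stdSimplex.ext _ _ fun t ↦ ?_) (stdSimplex.ext _ _ fun t ↦ ?_)
  · refine Fin.ext ((prismSimplex_fst (Fin.last (n + 1)) s ⟨t + n, by lia⟩).trans ?_)
    rw [hs]
    change _ = n + 1
    simp only [Fin.val_last]
    split_ifs <;> lia
  · have h := prismSimplex_snd_eq_zero_iff (Fin.last (n + 1)) s ⟨t + n, by lia⟩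
    rw [hs] at h
    change _ = t
    refine (?_ : ∀ a b : Fin 2, (a = 0 ↔ b = 0) → a = b) _ _ (h.trans ?_)
    · decide
    · rw [Fin.ext_iff]
      simp

/-- An inner fibration of `∞`-categories has the right lifting property with respect to
`∂Δ[n + 1] ⊗ Δ[1] ∪ Δ[n + 1] ⊗ {1} ⊆ Δ[n + 1] ⊗ Δ[1]`, for those lifting problems in which
`{n + 1} ⊗ Δ[1]` is sent to an invertible edge. -/
theorem exists_lift_prism (hp : innerFibrations p) {n : ℕ}
    (f : (prismFiltration.{u} (n + 1) 0 : SSet.{u}) ⟶ X) (g : Δ[n + 1] ⊗ Δ[1] ⟶ Y)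
    (w : f ≫ p = (prismFiltration (n + 1) 0).ι ≫ g)
    (hf : IsInvertible (f.app _ ⟨prismLastEdge (n + 1), prismLastEdge_mem.{u} n 0⟩)) :
    ∃ l : Δ[n + 1] ⊗ Δ[1] ⟶ X, (prismFiltration (n + 1) 0).ι ≫ l = f ∧ l ≫ p = g := by
  have mono {k l : ℕ} (h : k ≤ l) :
      prismFiltration.{u} (n + 1) k ≤ prismFiltration (n + 1) l :=
    fun m z hz ↦ hz.imp_right fun hz t ht ↦ (hz t ht).trans_le h
  have key (k : ℕ) (hk : k ≤ n + 2) : ∃ l : (prismFiltration.{u} (n + 1) k : SSet.{u}) ⟶ X,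
      Subcomplex.homOfLE (mono (Nat.zero_le k)) ≫ l = f ∧
        l ≫ p = (prismFiltration (n + 1) k).ι ≫ g := by
    induction k with
    | zero => exact ⟨f, rfl, w⟩
    | succ k ih =>
      obtain ⟨l, h₁, h₂⟩ := ih (by lia)
      obtain ⟨i, rfl⟩ : ∃ i : Fin (n + 2), i.val = k := ⟨⟨k, hk⟩, rfl⟩
      have hi := preimage_prismFiltration.{u} (n + 1) i
      obtain ⟨s, h₃, h₄⟩ : ∃ s : Δ[n + 2] ⟶ X,
          ((prismFiltration (n + 1) i).preimage (prismSimplex (n + 1) i)).ι ≫ s =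
            (prismFiltration (n + 1) i).fromPreimage (prismSimplex (n + 1) i) ≫ l ∧
          s ≫ p = prismSimplex (n + 1) i ≫ g := by
        have w' : ((prismFiltration (n + 1) i).fromPreimage (prismSimplex (n + 1) i) ≫ l) ≫ p =
            ((prismFiltration (n + 1) i).preimage (prismSimplex (n + 1) i)).ι ≫
              prismSimplex (n + 1) i ≫ g := by
          rw [Category.assoc, h₂]
          rfl
        refine exists_lift_of_inner_or_last_horn hp i hi _ _ w' ?_
        rintro e rfl he
        -- For the last simplex, the last edge is `{n + 1} ⊗ Δ[1]`. It already lies in stage `0`, so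
        -- its image is the edge assumed invertible.
        have he' : (prismSimplex (n + 1) (Fin.last _)).app _ e.1 = prismLastEdge (n + 1) := by
          rw [he, lastEdge_naturality, lastEdge_prismSimplex]
        have h₃ := ConcreteCategory.congr_hom (NatTrans.congr_app h₁ (op ⦋1⦌))
            ⟨prismLastEdge.{u} (n + 1), prismLastEdge_mem.{u} n 0⟩
        convert! hf using 1
        rw [← h₃]
        exact congr_arg (l.app (op ⦋1⦌)) (Subtype.ext he')
      obtain ⟨l', h₅, h₆⟩ := Subcomplex.exists_lift_sup_range (p := p) _
        (prismSimplex (n + 1) i) l g h₂ s h₃ h₄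
      have h := prismFiltration_succ.{u} (n + 1) i
      refine ⟨Subcomplex.homOfLE h.le ≫ l', ?_, ?_⟩
      · rw [← h₁, ← h₅]
        rfl
      · rw [Category.assoc, h₆]
        rfl
  obtain ⟨l, h₁, h₂⟩ := key (n + 2) le_rfl
  have htop := prismFiltration_eq_top.{u} (n + 1)
  refine ⟨Subcomplex.lift (𝟙 _) (by simp [htop]) ≫ l, ?_, ?_⟩
  · rw [← h₁]
    rfl
  · rw [Category.assoc, h₂]
    rfl

end BoxLifting

end SSet

namespace SSet
open Opposite

/-! ### Vertices of mapping objects -/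

section FunCalculus

open MonoidalClosed

variable {W X Y Z : SSet.{u}}

lemma Fun.vertex_bijective : Function.Bijective (Fun.vertex : (X ⟶ Y) → _) := by
  refine (Equiv.bijective (Fun X Y).unitHomEquiv).comp ⟨fun f g h ↦ curry'_injective h, fun g ↦ ?_⟩
  exact ⟨uncurry' g, curry'_uncurry' g⟩

lemma Fun.ihom_map_vertex (f : X ⟶ Y) (g : Y ⟶ Z) :
    ((ihom X).map g).app _ (Fun.vertex f) = Fun.vertex (f ≫ g) :=
  congr_arg (Fun X Z).unitHomEquiv (curry'_ihom_map f g)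

lemma Fun.precomp_vertex (f : W ⟶ X) (g : X ⟶ Y) :
    (Fun.precomp f Y).app _ (Fun.vertex g) = Fun.vertex (f ≫ g) := by
  refine congr_arg (Fun W Y).unitHomEquiv (a₁ := curry' g ≫ (pre f).app Y) (a₂ := curry' (f ≫ g)) ?_
  apply uncurry_injective
  rw [uncurry_natural_left, uncurry_pre, curry', curry', uncurry_curry,
    whisker_exchange_assoc, ← uncurry_eq, uncurry_curry, rightUnitor_naturality_assoc]

lemma Fun.curry_app_vertex {K : SSet.{u}} (h : X ⊗ K ⟶ Y) (v : K _⦋0⦌) :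
    (curry h).app _ v = Fun.vertex (CartesianMonoidalCategory.lift (𝟙 X) (SSet.const v) ≫ h) := by
  refine (congr_arg ((curry h).app _) (K.unitHomEquiv.apply_symm_apply v).symm).trans ?_
  refine congr_arg (Fun X Y).unitHomEquiv (a₁ := K.unitHomEquiv.symm v ≫ curry h)
    (a₂ := curry' _) ?_
  rw [← curry_natural_left, curry']
  rfl

lemma Fun.ev_vertex (f : X ⟶ Y) {n : ℕ} (x : X _⦋n⦌) :
    ((ihom.ev X).app Y).app (op ⦋n⦌)
      (x, (Fun X Y).map (SimplexCategory.const ⦋n⦌ ⦋0⦌ 0).op (Fun.vertex f)) = f.app _ x := by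
  have h := whiskerLeft_curry'_ihom_ev_app f
  have h' := ConcreteCategory.congr_hom (NatTrans.congr_app h (op ⦋n⦌))
    (show (X ⊗ 𝟙_ SSet.{u} : SSet.{u}) _⦋n⦌ from (x, (PUnit.unit : PUnit.{u + 1})))
  refine Eq.trans ?_ h'
  exact congr_arg (fun z ↦ ((ihom.ev X).app Y).app (op ⦋n⦌) (x, z))
    ((curry' f).naturality_apply (SimplexCategory.const ⦋n⦌ ⦋0⦌ 0).op PUnit.unit).symm

end FunCalculus

/-! ### Equivalence of maps and 2-out-of-3 -/

section NatEquiv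

variable {W X Y Z : SSet.{u}}

/-- Two maps `f` and `g` from `X` to an `∞`-category `Y` are equivalent if there is an
equivalence from `f` to `g` in `Fun(X, Y)`. -/
def NatEquiv (f g : X ⟶ Y) : Prop :=
  ∃ e : Edge (Fun.vertex f) (Fun.vertex g), e.IsEquivalence

section

variable [Quasicategory Y]

lemma natEquiv_iff (f g : X ⟶ Y) :
    NatEquiv f g ↔ ∃ e : Edge (Fun.vertex f) (Fun.vertex g), IsIso e.homMk₂ :=
  exists_congr fun e ↦ e.isEquivalence_iff.trans e.nonempty_invStruct_iff_isIso

lemma natEquiv_iff_nonempty_iso (f g : X ⟶ Y) :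
    NatEquiv f g ↔ Nonempty (Truncated.HomotopyCategory₂.mk (A := (truncation 2).obj (Fun X Y))
      (Fun.vertex f) ≅ .mk (Fun.vertex g)) := by
  rw [natEquiv_iff]
  refine ⟨fun ⟨e, he⟩ ↦ ⟨asIso e.homMk₂⟩, fun ⟨i⟩ ↦ ?_⟩
  obtain ⟨e, he⟩ := Edge.homMk₂_surjective i.hom
  exact ⟨e, he ▸ inferInstance⟩

lemma NatEquiv.refl (f : X ⟶ Y) : NatEquiv f f :=
  (natEquiv_iff_nonempty_iso f f).2 ⟨Iso.refl _⟩

lemma NatEquiv.symm {f g : X ⟶ Y} (h : NatEquiv f g) : NatEquiv g f := by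
  rw [natEquiv_iff_nonempty_iso] at h ⊢
  exact ⟨h.some.symm⟩

lemma NatEquiv.trans {f g h : X ⟶ Y} (h₁ : NatEquiv f g) (h₂ : NatEquiv g h) : NatEquiv f h := by
  rw [natEquiv_iff_nonempty_iso] at h₁ h₂ ⊢
  exact ⟨h₁.some ≪≫ h₂.some⟩

end

lemma Edge.IsEquivalence.map {x y : X _⦋0⦌} {e : Edge x y} [Quasicategory X]
    (he : e.IsEquivalence) (f : X ⟶ Y) : (e.map f).IsEquivalence := by
  rw [Edge.isEquivalence_iff] at he
  exact (he.some.map f).isEquivalence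

lemma NatEquiv.of_edge {f g : X ⟶ Y} {x y : (Fun X Y) _⦋0⦌} (e : Edge x y)
    (he : e.IsEquivalence) (hx : x = Fun.vertex f) (hy : y = Fun.vertex g) : NatEquiv f g := by
  subst hx hy
  exact ⟨e, he⟩

lemma NatEquiv.postcomp [Quasicategory Y] {f g : X ⟶ Y} (h : NatEquiv f g) (k : Y ⟶ Z) :
    NatEquiv (f ≫ k) (g ≫ k) := by
  obtain ⟨e, he⟩ := h
  exact .of_edge _ (he.map ((ihom X).map k)) (Fun.ihom_map_vertex f k) (Fun.ihom_map_vertex g k)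

lemma NatEquiv.precomp [Quasicategory Y] {f g : X ⟶ Y} (h : NatEquiv f g) (k : W ⟶ X) :
    NatEquiv (k ≫ f) (k ≫ g) := by
  obtain ⟨e, he⟩ := h
  exact .of_edge _ (he.map (Fun.precomp k Y)) (Fun.precomp_vertex k f) (Fun.precomp_vertex k g)

lemma isEquivalenceOfQuasicategories_iff [Quasicategory X] [Quasicategory Y] (f : X ⟶ Y) :
    IsEquivalenceOfQuasicategories f ↔
      ∃ g : Y ⟶ X, NatEquiv (f ≫ g) (𝟙 X) ∧ NatEquiv (g ≫ f) (𝟙 Y) := Iff.rfl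

namespace IsEquivalenceOfQuasicategories

variable [Quasicategory X] [Quasicategory Y] [Quasicategory Z] {f : X ⟶ Y} {g : Y ⟶ Z}

lemma comp (hf : IsEquivalenceOfQuasicategories f) (hg : IsEquivalenceOfQuasicategories g) :
    IsEquivalenceOfQuasicategories (f ≫ g) := by
  obtain ⟨f', h₁, h₂⟩ := (isEquivalenceOfQuasicategories_iff _).1 hf
  obtain ⟨g', h₃, h₄⟩ := (isEquivalenceOfQuasicategories_iff _).1 hg
  refine (isEquivalenceOfQuasicategories_iff _).2 ⟨g' ≫ f', NatEquiv.trans ?_ h₁, NatEquiv.trans ?_ h₄⟩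
  · simpa using (h₃.precomp f).postcomp f'
  · simpa using (h₂.precomp g').postcomp g

lemma of_comp_left (hf : IsEquivalenceOfQuasicategories f)
    (hfg : IsEquivalenceOfQuasicategories (f ≫ g)) : IsEquivalenceOfQuasicategories g := by
  obtain ⟨f', h₁, h₂⟩ := (isEquivalenceOfQuasicategories_iff _).1 hf
  obtain ⟨h, h₃, h₄⟩ := (isEquivalenceOfQuasicategories_iff _).1 hfg
  refine (isEquivalenceOfQuasicategories_iff _).2 ⟨h ≫ f,
    NatEquiv.trans (NatEquiv.trans (NatEquiv.symm ?_) ((h₃.precomp f').postcomp f)) ?_,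
    by simpa using h₄⟩
  · simpa using h₂.postcomp (g ≫ h ≫ f)
  · simpa using h₂

lemma of_comp_right (hg : IsEquivalenceOfQuasicategories g)
    (hfg : IsEquivalenceOfQuasicategories (f ≫ g)) : IsEquivalenceOfQuasicategories f := by
  obtain ⟨g', h₁, h₂⟩ := (isEquivalenceOfQuasicategories_iff _).1 hg
  obtain ⟨h, h₃, h₄⟩ := (isEquivalenceOfQuasicategories_iff _).1 hfg
  refine (isEquivalenceOfQuasicategories_iff _).2 ⟨g ≫ h, by simpa using h₃,
    NatEquiv.trans (NatEquiv.trans (NatEquiv.symm ?_) ((h₄.precomp g).postcomp g')) ?_⟩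
  · simpa using h₁.precomp (g ≫ h ≫ f)
  · simpa using h₁

end IsEquivalenceOfQuasicategories

namespace IsCategoricalEquivalence

variable {f : X ⟶ Y} {g : Y ⟶ Z}

lemma precomp_comp (f : X ⟶ Y) (g : Y ⟶ Z) (C : SSet.{u}) :
    Fun.precomp (f ≫ g) C = Fun.precomp g C ≫ Fun.precomp f C :=
  NatTrans.congr_app (MonoidalClosed.pre_map f g) C

lemma comp (hf : IsCategoricalEquivalence f) (hg : IsCategoricalEquivalence g) :
    IsCategoricalEquivalence (f ≫ g) := by
  intro C _
  rw [precomp_comp]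
  exact (hg C).comp (hf C)

lemma of_comp_left (hf : IsCategoricalEquivalence f) (hfg : IsCategoricalEquivalence (f ≫ g)) :
    IsCategoricalEquivalence g := by
  intro C _
  have := hfg C
  rw [precomp_comp] at this
  exact (hf C).of_comp_right this

lemma of_comp_right (hg : IsCategoricalEquivalence g) (hfg : IsCategoricalEquivalence (f ≫ g)) :
    IsCategoricalEquivalence f := by
  intro C _
  have := hfg C
  rw [precomp_comp] at this
  exact (hg C).of_comp_left this

end IsCategoricalEquivalence

end NatEquiv

end SSet

namespace SSet
open Opposite

/-! ### Equivalences of ∞-categories induce equivalences of homotopy categories -/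

section HomotopyCategory

open MonoidalClosed

variable {X Y Z : SSet.{u}}

lemma map_const_zero (x : X _⦋0⦌) :
    X.map (SimplexCategory.const ⦋0⦌ ⦋0⦌ 0).op x = x := by
  rw [Subsingleton.elim (SimplexCategory.const ⦋0⦌ ⦋0⦌ 0) (𝟙 _), op_id, Functor.map_id_apply]

lemma map_const_one (x : X _⦋0⦌) :
    X.map (SimplexCategory.const ⦋1⦌ ⦋0⦌ 0).op x = X.σ 0 x := by
  rw [Subsingleton.elim (SimplexCategory.const ⦋1⦌ ⦋0⦌ 0) (SimplexCategory.σ 0)]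
  rfl

lemma Fun.ev_vertex_zero (f : X ⟶ Y) (x : X _⦋0⦌) :
    ((ihom.ev X).app Y).app (op ⦋0⦌) (x, Fun.vertex f) = f.app _ x := by
  rw [← Fun.ev_vertex f x, map_const_zero]

lemma Fun.ev_vertex_one (f : X ⟶ Y) (x : X _⦋1⦌) :
    ((ihom.ev X).app Y).app (op ⦋1⦌) (x, (Fun X Y).σ 0 (Fun.vertex f)) = f.app _ x := by
  rw [← Fun.ev_vertex f x, map_const_one]

/-- The evaluation at a vertex `x` of `X`. -/
noncomputable def Fun.evalAt (Y : SSet.{u}) (x : X _⦋0⦌) : Fun X Y ⟶ Y :=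
  CartesianMonoidalCategory.lift (SSet.const x) (𝟙 _) ≫ (ihom.ev X).app Y

lemma Fun.evalAt_vertex (f : X ⟶ Y) (x : X _⦋0⦌) :
    (Fun.evalAt Y x).app _ (Fun.vertex f) = f.app _ x := by
  rw [← Fun.ev_vertex_zero]
  exact congr_arg (fun z ↦ ((ihom.ev X).app Y).app (op ⦋0⦌) (z, Fun.vertex f)) (map_const_zero x)

lemma Fun.evalAt_app_one (x : X _⦋0⦌) (s : (Fun X Y) _⦋1⦌) :
    (Fun.evalAt Y x).app (op ⦋1⦌) s = ((ihom.ev X).app Y).app (op ⦋1⦌) (X.σ 0 x, s) :=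
  congr_arg (fun z ↦ ((ihom.ev X).app Y).app (op ⦋1⦌) (z, s)) (map_const_one x)

/-- The product of two edges. -/
def Edge.prod {x x' : X _⦋0⦌} {y y' : Y _⦋0⦌} (e : Edge x x') (e' : Edge y y') :
    Edge (X := X ⊗ Y) (x, y) (x', y') :=
  .mk (X := X ⊗ Y) (e.edge, e'.edge) (Prod.ext e.src_eq e'.src_eq) (Prod.ext e.tgt_eq e'.tgt_eq)

/-- The product of two compositions of edges. -/
def Edge.CompStruct.prod {x₀ x₁ x₂ : X _⦋0⦌} {y₀ y₁ y₂ : Y _⦋0⦌} {e₀₁ : Edge x₀ x₁}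
    {e₁₂ : Edge x₁ x₂} {e₀₂ : Edge x₀ x₂} {e₀₁' : Edge y₀ y₁} {e₁₂' : Edge y₁ y₂}
    {e₀₂' : Edge y₀ y₂} (h : CompStruct e₀₁ e₁₂ e₀₂) (h' : CompStruct e₀₁' e₁₂' e₀₂') :
    CompStruct (e₀₁.prod e₀₁') (e₁₂.prod e₁₂') (e₀₂.prod e₀₂') :=
  .mk (X := X ⊗ Y) (h.simplex, h'.simplex) (Prod.ext h.d₂ h'.d₂) (Prod.ext h.d₀ h'.d₀)
    (Prod.ext h.d₁ h'.d₁)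

/-- The component at a vertex `x` of an edge in `Fun(X, Y)`. -/
noncomputable def Fun.component {f g : X ⟶ Y} (e : Edge (Fun.vertex f) (Fun.vertex g))
    (x : X _⦋0⦌) : Edge (f.app _ x) (g.app _ x) :=
  (e.map (Fun.evalAt Y x)).ofEq (Fun.evalAt_vertex f x) (Fun.evalAt_vertex g x)

/-- Evaluation sends the square `c × e` to the naturality square; both composites equal the image
`d` of its diagonal. -/
lemma Fun.component_naturality [Quasicategory Y] {f g : X ⟶ Y}
    (e : Edge (Fun.vertex f) (Fun.vertex g)) {x y : X _⦋0⦌} (c : Edge x y) :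
    (c.map f).homMk₂ ≫ (Fun.component e y).homMk₂ =
      (Fun.component e x).homMk₂ ≫ (c.map g).homMk₂ := by
  let d : Edge (f.app _ x) (g.app _ y) :=
    ((c.prod e).map ((ihom.ev X).app Y)).ofEq (Fun.ev_vertex_zero f x) (Fun.ev_vertex_zero g y)
  have h₁ : Edge.CompStruct (c.map f) (Fun.component e y) d :=
    (((Edge.CompStruct.compId c).prod (.idComp e)).map ((ihom.ev X).app Y)).ofEq
      (Fun.ev_vertex_one f _) (Fun.evalAt_app_one y _).symm rfl
  have h₂ : Edge.CompStruct (Fun.component e x) (c.map g) d :=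
    (((Edge.CompStruct.idComp c).prod (.compId e)).map ((ihom.ev X).app Y)).ofEq
      (Fun.evalAt_app_one x _).symm (Fun.ev_vertex_one g _) rfl
  rw [h₁.fac, h₂.fac]

variable [Quasicategory X] [Quasicategory Y]

lemma NatEquiv.nonempty_iso_hoMap₂ {f g : X ⟶ Y} (h : NatEquiv f g) :
    Nonempty (hoMap₂ f ≅ hoMap₂ g) := by
  obtain ⟨e, he⟩ := h
  rw [Edge.isEquivalence_iff] at he
  have (x : X _⦋0⦌) : IsIso (Fun.component e x).homMk₂ :=
    (Edge.nonempty_invStruct_iff_isIso _).1 ⟨(he.some.map (Fun.evalAt Y x)).ofEq rfl⟩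
  refine ⟨NatIso.ofComponents (fun x ↦ @asIso _ _ _ _ _ (this x.pt)) ?_⟩
  rintro ⟨x⟩ ⟨y⟩ c
  obtain ⟨c, rfl⟩ := Edge.homMk₂_surjective (X := X) c
  exact Fun.component_naturality e c

/-- The isomorphism between `hoMap₂ (𝟙 X)` and the identity functor. -/
noncomputable def hoMap₂Id (X : SSet.{u}) [Quasicategory X] : hoMap₂ (𝟙 X) ≅ 𝟭 _ :=
  NatIso.ofComponents (fun _ ↦ Iso.refl _) (by
    rintro ⟨x⟩ ⟨y⟩ c
    obtain ⟨c, rfl⟩ := Edge.homMk₂_surjective (X := X) c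
    exact (Category.comp_id _).trans (Category.id_comp _).symm)

/-- The compatibility of `hoMap₂` with the composition. -/
noncomputable def hoMap₂Comp [Quasicategory Z] (f : X ⟶ Y) (g : Y ⟶ Z) :
    hoMap₂ (f ≫ g) ≅ hoMap₂ f ⋙ hoMap₂ g :=
  NatIso.ofComponents (fun _ ↦ Iso.refl _) (by
    rintro ⟨x⟩ ⟨y⟩ c
    obtain ⟨c, rfl⟩ := Edge.homMk₂_surjective (X := X) c
    exact (Category.comp_id _).trans (Category.id_comp _).symm)

lemma IsEquivalenceOfQuasicategories.isEquivalence_hoMap₂ {f : X ⟶ Y}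
    (hf : IsEquivalenceOfQuasicategories f) : (hoMap₂ f).IsEquivalence := by
  obtain ⟨g, h₁, h₂⟩ := (isEquivalenceOfQuasicategories_iff f).1 hf
  exact (CategoryTheory.Equivalence.mk (hoMap₂ f) (hoMap₂ g)
    ((hoMap₂Id X).symm ≪≫ h₁.nonempty_iso_hoMap₂.some.symm ≪≫ hoMap₂Comp f g)
    ((hoMap₂Comp g f).symm ≪≫ h₂.nonempty_iso_hoMap₂.some ≪≫ hoMap₂Id Y)).isEquivalence_functor

lemma IsEquivalenceOfQuasicategories.exists_edge {f : X ⟶ Y}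
    (hf : IsEquivalenceOfQuasicategories f) (y : Y _⦋0⦌) :
    ∃ (x : X _⦋0⦌) (e : Edge y (f.app _ x)), Nonempty e.InvStruct := by
  have := hf.isEquivalence_hoMap₂
  let i := (hoMap₂ f).objObjPreimageIso (.mk y)
  obtain ⟨e, he⟩ := Edge.homMk₂_surjective (X := Y) i.inv
  refine ⟨_, e, (Edge.nonempty_invStruct_iff_isIso e).2 ?_⟩
  rw [he]
  exact (inferInstance : IsIso i.inv)

lemma IsEquivalenceOfQuasicategories.exists_lift_edge {f : X ⟶ Y}
    (hf : IsEquivalenceOfQuasicategories f) {x x' : X _⦋0⦌} (e : Edge (f.app _ x) (f.app _ x')) :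
    ∃ e' : Edge x x', (e'.map f).homMk₂ = e.homMk₂ := by
  have := hf.isEquivalence_hoMap₂
  let e₂ : (hoMap₂ f).obj (.mk x) ⟶ (hoMap₂ f).obj (.mk x') := e.homMk₂
  obtain ⟨c, hc⟩ := (hoMap₂ f).map_surjective e₂
  obtain ⟨e', rfl⟩ := Edge.homMk₂_surjective (X := X) c
  exact ⟨e', hc⟩

end HomotopyCategory

/-! ### Trivial fibrations and inner anodyne maps are categorical equivalences -/

section TrivialFibration

open MonoidalClosed MorphismProperty

variable {X Y : SSet.{u}}

lemma exists_lift_of_disjoint {P D : SSet.{u}} {p : X ⟶ Y} (hp : (monomorphisms SSet.{u}).rlp p)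
    (i₀ i₁ : D ⟶ P) [Mono i₀] [Mono i₁] (h : Subcomplex.range i₀ ⊓ Subcomplex.range i₁ = ⊥)
    (f₀ f₁ : D ⟶ X) (g : P ⟶ Y) (h₀ : f₀ ≫ p = i₀ ≫ g) (h₁ : f₁ ≫ p = i₁ ≫ g) :
    ∃ l : P ⟶ X, i₀ ≫ l = f₀ ∧ i₁ ≫ l = f₁ ∧ l ≫ p = g := by
  have sq : Subcomplex.BicartSq ⊥ (Subcomplex.range i₀) (Subcomplex.range i₁)
    (Subcomplex.range i₀ ⊔ Subcomplex.range i₁) := ⟨rfl, h⟩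
  let f := sq.isPushout.desc (inv (Subcomplex.toRange i₀) ≫ f₀)
    (inv (Subcomplex.toRange i₁) ≫ f₁) (Subsingleton.elim _ _)
  have hf₀ : Subcomplex.toRange i₀ ≫ Subcomplex.homOfLE sq.le₂₄ ≫ f = f₀ := by
    rw [sq.isPushout.inl_desc, IsIso.hom_inv_id_assoc]
  have hf₁ : Subcomplex.toRange i₁ ≫ Subcomplex.homOfLE sq.le₃₄ ≫ f = f₁ := by
    rw [sq.isPushout.inr_desc, IsIso.hom_inv_id_assoc]
  have w : CommSq f (Subcomplex.range i₀ ⊔ Subcomplex.range i₁).ι p g := ⟨by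
    apply sq.isPushout.hom_ext
    · rw [← cancel_epi (Subcomplex.toRange i₀), reassoc_of% hf₀, h₀]
      rfl
    · rw [← cancel_epi (Subcomplex.toRange i₁), reassoc_of% hf₁, h₁]
      rfl⟩
  have := hp _ (monomorphisms.infer_property (Subcomplex.range i₀ ⊔ Subcomplex.range i₁).ι)
  exact ⟨w.lift,
    (congr_arg (fun z ↦ Subcomplex.toRange i₀ ≫ Subcomplex.homOfLE sq.le₂₄ ≫ z) w.fac_left).trans
      hf₀,
    (congr_arg (fun z ↦ Subcomplex.toRange i₁ ≫ Subcomplex.homOfLE sq.le₃₄ ≫ z) w.fac_left).trans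
      hf₁, w.fac_right⟩

lemma coherentIso.x₀_ne_x₁ : coherentIso.x₀.{u} ≠ coherentIso.x₁ := by
  intro h
  have h' : WalkingIso.zero.{u} = WalkingIso.one := congr_arg (fun (F : coherentIso _⦋0⦌) ↦
    (show ComposableArrows WalkingIso.{u} 0 from F).obj 0) h
  exact absurd (congr_arg WalkingIso.equivBool h') (by decide)

/-- The inclusion of `X` in `X ⊗ K` given by a vertex of `K`. -/
noncomputable abbrev inclAt (X : SSet.{u}) {K : SSet.{u}} (v : K _⦋0⦌) : X ⟶ X ⊗ K :=
  CartesianMonoidalCategory.lift (𝟙 X) (SSet.const v)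

instance {K : SSet.{u}} (v : K _⦋0⦌) : Mono (inclAt X v) :=
  mono_of_mono_fac (CartesianMonoidalCategory.lift_fst (𝟙 X) (SSet.const v))

lemma range_inclAt_inf {K : SSet.{u}} {v w : K _⦋0⦌} (h : v ≠ w) :
    Subcomplex.range (inclAt X v) ⊓ Subcomplex.range (inclAt X w) = ⊥ := by
  rw [eq_bot_iff]
  rintro ⟨⟨n⟩⟩ _ ⟨⟨x, rfl⟩, ⟨y, hy⟩⟩
  refine h (?_ : v = w)
  have hy' : K.map (SimplexCategory.const ⦋n⦌ ⦋0⦌ 0).op w =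
      K.map (SimplexCategory.const ⦋n⦌ ⦋0⦌ 0).op v := congr_arg Prod.snd hy
  replace hy' := congr_arg (K.map (SimplexCategory.const ⦋0⦌ ⦋n⦌ 0).op) hy'
  rw [← Functor.map_comp_apply, ← Functor.map_comp_apply, ← op_comp,
    Subsingleton.elim (SimplexCategory.const ⦋0⦌ ⦋n⦌ 0 ≫ SimplexCategory.const ⦋n⦌ ⦋0⦌ 0) (𝟙 _),
    op_id, Functor.map_id_apply, Functor.map_id_apply] at hy'
  exact hy'.symm

/-- The homotopy is a lift against the inclusion of the two ends of `X ⊗ coherentIso`, so its edge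
is the image of an invertible edge. Since `X` need not be an ∞-category, the explicit `InvStruct` is
recorded: it is preserved by every map. -/
lemma exists_section_of_rlp {p : X ⟶ Y} (hp : (monomorphisms SSet.{u}).rlp p) :
    ∃ (s : Y ⟶ X) (e : Edge (Fun.vertex (p ≫ s)) (Fun.vertex (𝟙 X))),
      s ≫ p = 𝟙 Y ∧ Nonempty e.InvStruct := by
  have sq : CommSq (Limits.initial.to X) (Limits.initial.to Y) p (𝟙 Y) := ⟨Subsingleton.elim _ _⟩
  have := hp _ (monomorphisms.infer_property (Limits.initial.to Y))
  have hs : sq.lift ≫ p = 𝟙 Y := sq.fac_right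
  obtain ⟨l, h₀, h₁, -⟩ := exists_lift_of_disjoint hp (inclAt X coherentIso.x₀)
    (inclAt X coherentIso.x₁) (range_inclAt_inf coherentIso.x₀_ne_x₁) (p ≫ sq.lift) (𝟙 X)
    (SemiCartesianMonoidalCategory.fst _ _ ≫ p) (by simp [hs]) (by simp)
  refine ⟨sq.lift, (coherentIso.hom.map (curry l)).ofEq ?_ ?_, hs,
    ⟨(coherentIso.invStructHom.map (curry l)).ofEq rfl⟩⟩
  · rw [Fun.curry_app_vertex, h₀]
  · rw [Fun.curry_app_vertex, h₁]

lemma isEquivalenceOfQuasicategories_of_rlp [Quasicategory X] [Quasicategory Y] {p : X ⟶ Y}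
    (hp : (monomorphisms SSet.{u}).rlp p) : IsEquivalenceOfQuasicategories p := by
  obtain ⟨s, e, hs, ⟨he⟩⟩ := exists_section_of_rlp hp
  exact (isEquivalenceOfQuasicategories_iff p).2 ⟨s, ⟨e, he.isEquivalence⟩, hs ▸ .refl _⟩

/-- The map `Fun(X, X) ⟶ Fun(Fun(X, C), Fun(X, C))` given by precomposition. -/
noncomputable def Fun.precompMap (X C : SSet.{u}) : Fun X X ⟶ Fun (Fun X C) (Fun X C) :=
  curry ((β_ (Fun X C) (Fun X X)).hom ≫ MonoidalClosed.comp X X C)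

lemma Fun.precompMap_vertex (f : X ⟶ X) (C : SSet.{u}) :
    (Fun.precompMap X C).app _ (Fun.vertex f) = Fun.vertex (Fun.precomp f C) := by
  refine congr_arg (Fun (Fun X C) (Fun X C)).unitHomEquiv (a₁ := curry' f ≫ Fun.precompMap X C)
    (a₂ := curry' _) ?_
  rw [Fun.precompMap, ← curry_natural_left, BraidedCategory.braiding_naturality_right_assoc,
    curry'_whiskerRight_comp, braiding_leftUnitor_assoc]
  rfl

/-- Precomposition carries the section and the invertible homotopy from `Fun(X, X)` to `Fun(Fun(X,
C), Fun(X, C))`. -/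
lemma isCategoricalEquivalence_of_rlp {p : X ⟶ Y}
    (hp : (monomorphisms SSet.{u}).rlp p) : IsCategoricalEquivalence p := by
  obtain ⟨s, e, hs, ⟨he⟩⟩ := exists_section_of_rlp hp
  intro C _
  refine (isEquivalenceOfQuasicategories_iff _).2 ⟨Fun.precomp s C, ?_, ?_⟩
  · rw [← IsCategoricalEquivalence.precomp_comp, hs]
    have : Fun.precomp (𝟙 Y) C = 𝟙 _ := NatTrans.congr_app (MonoidalClosed.pre_id Y) C
    rw [this]
    exact .refl _
  · rw [← IsCategoricalEquivalence.precomp_comp]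
    have : Fun.precomp (𝟙 X) C = 𝟙 _ := NatTrans.congr_app (MonoidalClosed.pre_id X) C
    rw [← this]
    exact .of_edge _ (he.map (Fun.precompMap X C)).isEquivalence (Fun.precompMap_vertex _ _)
      (Fun.precompMap_vertex _ _)

lemma IsTrivialKanFibration.rlp {p : X ⟶ Y} (hp : IsTrivialKanFibration p) :
    (monomorphisms SSet.{u}).rlp p := by
  rw [rlp_monomorphisms]
  rintro _ _ _ ⟨n⟩
  exact hp n

lemma isTrivialKanFibration_of_rlp {p : X ⟶ Y} (hp : (monomorphisms SSet.{u}).rlp p) :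
    IsTrivialKanFibration p :=
  fun _ ↦ hp _ (monomorphisms.infer_property _)

/-- By adjunction, this says that the pushout-product of an inner anodyne map with a monomorphism is
inner anodyne. -/
lemma rlp_precomp {i : X ⟶ Y} (hi : innerAnodyneExtensions i) (C : SSet.{u}) [Quasicategory C] :
    (monomorphisms SSet.{u}).rlp (Fun.precomp i C) := by
  intro A B j (_ : Mono j)
  let sq₁₃ : MonoidalClosed.internalHom.PullbackObjObj i (Limits.terminal.from C) :=
    Functor.PullbackObjObj.ofIsTerminal MonoidalClosed.internalHom i (Limits.terminal.from C)
      Limits.terminalIsTerminal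
  let sq₁₂ := Functor.PushoutObjObj.ofHasPushout (curriedTensor SSet) i j
  change HasLiftingProperty j sq₁₃.π
  rw [← internalHomAdjunction₂.hasLiftingProperty_iff sq₁₂]
  exact innerAnodyneExtensions_pushoutObjObjι' sq₁₂ hi _ (mem_innerFibrations _)

lemma isCategoricalEquivalence_of_innerAnodyneExtensions {i : X ⟶ Y}
    (hi : innerAnodyneExtensions i) : IsCategoricalEquivalence i :=
  fun C _ ↦ isEquivalenceOfQuasicategories_of_rlp (rlp_precomp hi C)

end TrivialFibration

end SSet

namespace SSet
open Opposite

/-! ### The start of the prism filtration -/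

section BoundaryPrism

variable {X Y : SSet.{u}}

/-- The vertex `0` of `Δ[1]`. -/
def vertexZero : (Δ[1] : SSet.{u}) _⦋0⦌ := stdSimplex.objEquiv.symm (SimplexCategory.δ 1)

/-- The vertex `1` of `Δ[1]`. -/
def vertexOne : (Δ[1] : SSet.{u}) _⦋0⦌ := stdSimplex.objEquiv.symm (SimplexCategory.δ 0)

lemma prismFiltration_zero (n : ℕ) :
    ∂Δ[n].unionProd (Subcomplex.ofSimplex vertexOne.{u}) = prismFiltration n 0 := by
  ext ⟨⟨d⟩⟩ z
  obtain ⟨z₁, z₂⟩ := z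
  refine (Subcomplex.mem_unionProd_iff _ _ _).trans (or_comm.trans ((or_congr ?_ ?_).trans
    (mem_prismFiltration_iff _ _ (z₁, z₂)).symm))
  · refine (mem_boundary_iff_notMem_range z₁).trans (exists_congr fun v ↦ ?_)
    simp [Set.mem_range]
  · refine (Subcomplex.mem_ofSimplex_obj_iff _ z₂).trans ⟨?_, fun h ↦ ?_⟩
    · rintro ⟨f, rfl⟩ t ht
      exact (Fin.succAbove_ne (0 : Fin 2) (f.toOrderHom t) ht).elim
    · refine ⟨SimplexCategory.const _ _ 0, stdSimplex.ext _ _ fun t ↦ ?_⟩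
      have h' : z₂ t ≠ 0 := fun h' ↦ by simpa using h t h'
      change (1 : Fin 2) = z₂ t
      revert h'
      generalize z₂ t = a
      revert a
      decide

lemma exists_lift_boundary_prism [Quasicategory X] [Quasicategory Y] {p : X ⟶ Y}
    (hp : innerFibrations p) {n : ℕ}
    {B : (Δ[n + 1] ⊗ Δ[1] : SSet.{u}).Subcomplex} (hB : B = prismFiltration (n + 1) 0)
    (f : (B : SSet.{u}) ⟶ X) (g : Δ[n + 1] ⊗ Δ[1] ⟶ Y) (w : f ≫ p = B.ι ≫ g)
    (hf : ∀ e : (B : SSet.{u}) _⦋1⦌, e.1 = prismLastEdge (n + 1) → IsInvertible (f.app _ e)) :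
    ∃ l : Δ[n + 1] ⊗ Δ[1] ⟶ X, B.ι ≫ l = f ∧ l ≫ p = g := by
  subst hB
  exact exists_lift_prism hp f g w (hf _ rfl)

end BoundaryPrism

/-! ### Boundary lifting from compatible homotopies -/

section DeformationLifting

open MonoidalClosed

variable {X Y : SSet.{u}}

lemma inclAt_whiskerRight {K : SSet.{u}} (f : X ⟶ Y) (v : K _⦋0⦌) :
    inclAt X v ≫ f ▷ K = f ≫ inclAt Y v := rfl

lemma whiskerLeft_ofSimplex_ι {K : SSet.{u}} (v : K _⦋0⦌) :
    X ◁ (Subcomplex.ofSimplex v).ι =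
      SemiCartesianMonoidalCategory.fst X (Subcomplex.ofSimplex v : SSet.{u}) ≫ inclAt X v := by
  rw [Subcomplex.ofSimplex_ι]
  rfl

/-- If `p : X ⟶ Y` is an inner fibration of `∞`-categories, `g : Y ⟶ X` a map, `K` a homotopy
from `𝟙 X` to `p ≫ g` and `H` a homotopy from `𝟙 Y` to `g ≫ p` compatible with `K`, then `p` has
the right lifting property with respect to `∂Δ[n + 1]` as soon as `K` is an equivalence at each
vertex of `X`. -/
theorem hasLiftingProperty_boundary_of_homotopy [Quasicategory X] [Quasicategory Y] {p : X ⟶ Y}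
    (hp : innerFibrations p) {g : Y ⟶ X} (K : X ⊗ Δ[1] ⟶ X) (H : Y ⊗ Δ[1] ⟶ Y)
    (hK₀ : inclAt X vertexZero ≫ K = 𝟙 X) (hK₁ : inclAt X vertexOne ≫ K = p ≫ g)
    (hH₀ : inclAt Y vertexZero ≫ H = 𝟙 Y) (hH₁ : inclAt Y vertexOne ≫ H = g ≫ p)
    (hKH : K ≫ p = p ▷ Δ[1] ≫ H)
    (hK : ∀ x : X _⦋0⦌, IsInvertible (K.app (op ⦋1⦌) (X.σ 0 x, stdSimplex.objEquiv.symm (𝟙 _))))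
    (n : ℕ) : HasLiftingProperty ∂Δ[n + 1].ι p where
  sq_hasLift {u v} sq := by
    have hpo := Subcomplex.unionProd.isPushout ∂Δ[n + 1] (Subcomplex.ofSimplex vertexOne.{u})
    -- The prescribed values are `v ≫ g` on the end `1` and `K` applied to `u` on the boundary. They
    -- agree on the overlap since `K` ends at `p ≫ g`.
    let f := hpo.desc (SemiCartesianMonoidalCategory.fst _ _ ≫ v ≫ g) (u ▷ Δ[1] ≫ K) (by
      rw [whisker_exchange_assoc, whiskerLeft_ofSimplex_ι, Category.assoc, hK₁]
      change SemiCartesianMonoidalCategory.fst _ _ ≫ ∂Δ[n + 1].ι ≫ v ≫ g =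
        SemiCartesianMonoidalCategory.fst _ _ ≫ u ≫ p ≫ g
      rw [← sq.w_assoc])
    have hf₁ : Subcomplex.unionProd.ι₁ ∂Δ[n + 1] (Subcomplex.ofSimplex vertexOne.{u}) ≫ f =
      SemiCartesianMonoidalCategory.fst _ _ ≫ v ≫ g := hpo.inl_desc _ _ _
    have hf₂ : Subcomplex.unionProd.ι₂ ∂Δ[n + 1] (Subcomplex.ofSimplex vertexOne.{u}) ≫ f =
      u ▷ Δ[1] ≫ K := hpo.inr_desc _ _ _
    obtain ⟨l, hl, hlp⟩ := exists_lift_boundary_prism hp (prismFiltration_zero (n + 1)) f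
      (v ▷ Δ[1] ≫ H) (by
        apply hpo.hom_ext
        · rw [reassoc_of% hf₁, Subcomplex.unionProd.ι₁_ι_assoc, whiskerLeft_ofSimplex_ι,
            Category.assoc, ← hH₁]
          rfl
        · rw [reassoc_of% hf₂, hKH, ← comp_whiskerRight_assoc, sq.w]
          rfl) (by
        rintro ⟨e, he⟩ rfl
        -- The vertex `n + 1` lies in the boundary, so the distinguished edge goes to the component
        -- of `K` at the image of this vertex under `u`.
        let x : (∂Δ[n + 1] : SSet.{u}) _⦋0⦌ := ⟨stdSimplex.const (n + 1) (Fin.last _) (op ⦋0⦌),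
          by rw [boundary_obj_eq_univ 0 (n + 1)]; trivial⟩
        have h₁ : f.app _ ⟨prismLastEdge (n + 1), he⟩ = K.app (op ⦋1⦌)
            (u.app _ ((∂Δ[n + 1] : SSet.{u}).map (SimplexCategory.const ⦋1⦌ ⦋0⦌ 0).op x),
              stdSimplex.objEquiv.symm (𝟙 _)) :=
          congr_arg (fun m ↦ m.app (op ⦋1⦌)
            ((∂Δ[n + 1] : SSet.{u}).map (SimplexCategory.const ⦋1⦌ ⦋0⦌ 0).op x,
              stdSimplex.objEquiv.symm (𝟙 _))) hf₂
        have h₂ := (NatTrans.naturality_apply u (SimplexCategory.const ⦋1⦌ ⦋0⦌ 0).op x).trans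
          (map_const_one _)
        rw [h₁, h₂]
        exact hK _)
    -- At the end `0` both homotopies are identities, so the restriction of `l` solves the original
    -- problem.
    refine ⟨⟨⟨inclAt _ vertexZero ≫ l, ?_, ?_⟩⟩⟩
    · calc ∂Δ[n + 1].ι ≫ inclAt _ vertexZero ≫ l =
          inclAt _ vertexZero ≫ Subcomplex.unionProd.ι₂ ∂Δ[n + 1] _ ≫
            (∂Δ[n + 1].unionProd (Subcomplex.ofSimplex vertexOne.{u})).ι ≫ l := rfl
        _ = u ≫ inclAt _ vertexZero ≫ K := by rw [hl, hf₂]; rfl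
        _ = u := by rw [hK₀, Category.comp_id]
    · rw [Category.assoc, hlp, ← Category.assoc, inclAt_whiskerRight, Category.assoc, hH₀,
        Category.comp_id]

end DeformationLifting

end SSet

namespace SSet
open Opposite

/-! ### The special case of ∞-categories -/

section

open MonoidalClosed

variable {X Y : SSet.{u}}

lemma Edge.homMk₂_eq_of_ofEq [Quasicategory X] {x y x' y' : X _⦋0⦌} {a : Edge x y}
    {b : Edge x' y'} (hx : x = x') (hy : y = y') (h : b.homMk₂ = (a.ofEq hx hy).homMk₂) :
    a.homMk₂ = (b.ofEq hx.symm hy.symm).homMk₂ := by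
  subst hx hy
  exact h.symm

/-- A `2`-simplex with a degenerate face shows that the image of `k` is homotopic to `h`. Lifting it
along `Λ[2, 1]` replaces `k` by a homotopic edge lying strictly over `h`. -/
lemma Edge.exists_correction [Quasicategory X] [Quasicategory Y] {q : X ⟶ Y}
    (hq : innerFibrations q) {x y : X _⦋0⦌} (k : Edge x y) (hk : Nonempty k.InvStruct)
    (h : Edge (q.app _ x) (q.app _ y)) (hkh : (k.map q).homMk₂ = h.homMk₂) :
    ∃ k' : Edge x y, q.app _ k'.edge = h.edge ∧ Nonempty k'.InvStruct := by
  obtain ⟨c⟩ := (CompStruct.nonempty_iff (f := k.map q) (g := .id _) (h := h)).2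
    (by rw [homMk₂_id, Category.comp_id, hkh])
  obtain ⟨s, h₂, h₀, hs⟩ := ((innerFibrations_iff_fillsHorn q).1 hq 0 1 (by simp) (by simp)).two_one k.edge (Edge.id y).edge
    (k.tgt_eq.trans (Edge.id y).src_eq.symm) c.simplex c.d₂
    (c.d₀.trans (SSet.σ_naturality_apply q 0 y).symm)
  let k' : Edge x y := .mk (X.δ 1 s)
    (by rw [← k.src_eq, ← h₂]; exact (X.δ_comp_δ_apply (i := 1) (j := 1) le_rfl s).symm)
    (by rw [← (Edge.id y).tgt_eq, ← h₀]; exact X.δ_comp_δ_apply (i := 0) (j := 0) le_rfl s)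
  refine ⟨k', (SSet.δ_naturality_apply q 1 s).trans ((congr_arg _ hs).trans c.d₁), ?_⟩
  have hk' : k.homMk₂ ≫ (Edge.id y).homMk₂ = k'.homMk₂ :=
    (CompStruct.mk s h₂ h₀ rfl : CompStruct k (.id y) k').fac
  rw [homMk₂_id, Category.comp_id] at hk'
  rwa [nonempty_invStruct_iff_isIso, ← hk', ← nonempty_invStruct_iff_isIso]

/-- The homotopy given by a `1`-simplex of `Fun(X, Y)`. -/
noncomputable def Fun.homotopy (s : (Fun X Y) _⦋1⦌) : X ⊗ Δ[1] ⟶ Y :=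
  uncurry (yonedaEquiv.symm s)

lemma Fun.vertex_inclAt_zero_homotopy (s : (Fun X Y) _⦋1⦌) :
    Fun.vertex (inclAt X vertexZero ≫ Fun.homotopy s) = (Fun X Y).δ 1 s := by
  rw [← Fun.curry_app_vertex, Fun.homotopy, curry_uncurry]
  rfl

lemma Fun.vertex_inclAt_one_homotopy (s : (Fun X Y) _⦋1⦌) :
    Fun.vertex (inclAt X vertexOne ≫ Fun.homotopy s) = (Fun X Y).δ 0 s := by
  rw [← Fun.curry_app_vertex, Fun.homotopy, curry_uncurry]
  rfl

lemma Fun.homotopy_comp {Z : SSet.{u}} (s : (Fun X Y) _⦋1⦌) (f : Y ⟶ Z) :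
    Fun.homotopy s ≫ f = Fun.homotopy (((ihom X).map f).app _ s) := by
  rw [homotopy, homotopy, ← uncurry_natural_right, yonedaEquiv_symm_comp]

lemma Fun.whiskerRight_homotopy {W : SSet.{u}} (f : W ⟶ X) (s : (Fun X Y) _⦋1⦌) :
    f ▷ Δ[1] ≫ Fun.homotopy s = Fun.homotopy ((Fun.precomp f Y).app _ s) := by
  rw [homotopy, homotopy, ← uncurry_pre_app, yonedaEquiv_symm_comp]

lemma Fun.homotopy_app_one (s : (Fun X Y) _⦋1⦌) (x : X _⦋0⦌) :
    (Fun.homotopy s).app (op ⦋1⦌) (X.σ 0 x, stdSimplex.objEquiv.symm (𝟙 _)) =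
      (Fun.evalAt Y x).app _ s := by
  have h : (yonedaEquiv.symm s).app (op ⦋1⦌) (stdSimplex.objEquiv.symm (𝟙 _)) = s :=
    (Fun X Y).map_id_apply _ s
  rw [Fun.evalAt_app_one, homotopy, uncurry_eq]
  exact congr_arg (fun s ↦ ((ihom.ev X).app Y).app (op ⦋1⦌) (X.σ 0 x, s)) h

lemma IsBijectiveOnObjects.hasLiftingProperty_boundary_zero {p : X ⟶ Y}
    (hp : IsBijectiveOnObjects p) : HasLiftingProperty ∂Δ[0].ι p where
  sq_hasLift {u v} sq := by
    obtain ⟨x, hx⟩ := hp.surjective (yonedaEquiv v)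
    refine ⟨⟨⟨yonedaEquiv.symm x, boundary.hom_ext₀, ?_⟩⟩⟩
    rw [yonedaEquiv_symm_comp, Equiv.symm_apply_eq]
    exact hx

/-- An inner fibration between `∞`-categories which is a categorical equivalence and bijective on
objects is a trivial Kan fibration. -/
theorem isTrivialKanFibration_of_quasicategory [Quasicategory X] [Quasicategory Y] {p : X ⟶ Y}
    (hp : innerFibrations p) (hp₀ : IsBijectiveOnObjects p) (hp' : IsCategoricalEquivalence p) :
    IsTrivialKanFibration p := by
  have : InnerFibration p := ⟨hp⟩
  -- Essential surjectivity of `Fun(Y, X) ⟶ Fun(X, X)` provides the inverse `g` up to homotopy.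
  obtain ⟨g', k₀, hk₀⟩ := (hp' X).exists_edge (Fun.vertex (𝟙 X))
  obtain ⟨g, rfl⟩ := Fun.vertex_bijective.surjective g'
  let k₁ : Edge (Fun.vertex (𝟙 X)) (Fun.vertex (p ≫ g)) := k₀.ofEq rfl (Fun.precomp_vertex p g)
  have hk₁ : Nonempty k₁.InvStruct := ⟨hk₀.some.ofEq rfl⟩
  have e₀ : ((ihom X).map p).app _ (Fun.vertex (𝟙 X)) =
      (Fun.precomp p Y).app _ (Fun.vertex (𝟙 Y)) := by
    rw [Fun.ihom_map_vertex, Fun.precomp_vertex, Category.id_comp, Category.comp_id]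
  have e₁ : ((ihom X).map p).app _ (Fun.vertex (p ≫ g)) =
      (Fun.precomp p Y).app _ (Fun.vertex (g ≫ p)) := by
    rw [Fun.ihom_map_vertex, Fun.precomp_vertex, Category.assoc]
  -- Fullness of `Fun(Y, Y) ⟶ Fun(X, Y)` provides `h`, compatible with `k₁` only up to homotopy; the
  -- correction then makes the compatibility strict.
  obtain ⟨h, hh⟩ := (hp' Y).exists_lift_edge ((k₁.map ((ihom X).map p)).ofEq e₀ e₁)
  obtain ⟨k, hkh, hk⟩ := Edge.exists_correction (q := (ihom X).map p)
    (mem_innerFibrations _) k₁ hk₁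
    ((h.map (Fun.precomp p Y)).ofEq e₀.symm e₁.symm) (Edge.homMk₂_eq_of_ofEq e₀ e₁ hh)
  intro n
  obtain _ | n := n
  · exact hp₀.hasLiftingProperty_boundary_zero
  · refine hasLiftingProperty_boundary_of_homotopy hp (g := g) (Fun.homotopy k.edge)
      (Fun.homotopy h.edge) ?_ ?_ ?_ ?_ ?_ (fun x ↦ ?_) n
    · exact Fun.vertex_bijective.injective ((Fun.vertex_inclAt_zero_homotopy _).trans k.src_eq)
    · exact Fun.vertex_bijective.injective ((Fun.vertex_inclAt_one_homotopy _).trans k.tgt_eq)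
    · exact Fun.vertex_bijective.injective ((Fun.vertex_inclAt_zero_homotopy _).trans h.src_eq)
    · exact Fun.vertex_bijective.injective ((Fun.vertex_inclAt_one_homotopy _).trans h.tgt_eq)
    · rw [Fun.homotopy_comp, Fun.whiskerRight_homotopy, hkh]
      rfl
    · rw [Fun.homotopy_app_one]
      exact (k.isInvertible_iff.2 hk).map _

end

end SSet

namespace SSet
open Opposite

/-! ### Bijectivity on objects, factorizations and the retract argument -/

section

open MorphismProperty

variable {X Y Z A B : SSet.{u}}

/-- The subcomplex of `X` consisting of the simplices all of whose vertices belong to `S`. -/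
def fullSubcomplex (S : Set (X _⦋0⦌)) : X.Subcomplex where
  obj n := { x | ∀ v : ⦋0⦌ ⟶ n.unop, X.map v.op x ∈ S }
  map {n m} f x hx v := by
    have := hx (v ≫ f.unop)
    rwa [op_comp, Functor.map_comp_apply] at this

lemma mem_fullSubcomplex_zero_iff (S : Set (X _⦋0⦌)) (x : X _⦋0⦌) :
    x ∈ (fullSubcomplex S).obj (op ⦋0⦌) ↔ x ∈ S := by
  refine ⟨fun h ↦ ?_, fun h v ↦ ?_⟩
  · simpa using h (𝟙 _)
  · rw [Subsingleton.elim v (𝟙 _)]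
    simpa using h

lemma hasLiftingProperty_fullSubcomplex_ι (i : A ⟶ B)
    (hi : Function.Surjective (fun x : A _⦋0⦌ ↦ i.app _ x)) (S : Set (X _⦋0⦌)) :
    HasLiftingProperty i (fullSubcomplex S).ι where
  sq_hasLift {f g} sq := by
    have hg : Subcomplex.range g ≤ fullSubcomplex S := by
      rintro ⟨⟨n⟩⟩ _ ⟨b, rfl⟩ v
      obtain ⟨a, ha⟩ := hi (B.map v.op b)
      have h₁ : X.map v.op (g.app _ b) = (f.app _ a).1 := by
        refine (NatTrans.naturality_apply g v.op b).symm.trans ?_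
        rw [← ha]
        exact (ConcreteCategory.congr_hom (NatTrans.congr_app sq.w (op ⦋0⦌)) a).symm
      exact h₁ ▸ (mem_fullSubcomplex_zero_iff S _).1 (f.app _ a).2
    refine ⟨⟨⟨Subcomplex.lift g hg, ?_, Subcomplex.lift_ι g hg⟩⟩⟩
    rw [← cancel_mono (fullSubcomplex S).ι, Category.assoc, Subcomplex.lift_ι, sq.w]

/-- The inclusion of the full subcomplex on the vertices hit by `f` lies in `I.rlp`, so `f` lifts
against it. A lift of `𝟙 Y` shows that every vertex is hit. -/
lemma surjective_of_llp_rlp {I : MorphismProperty SSet.{u}}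
    (hI : ∀ ⦃A B : SSet.{u}⦄ (i : A ⟶ B), I i →
      Function.Surjective (fun x : A _⦋0⦌ ↦ i.app (op ⦋0⦌) x))
    {f : X ⟶ Y} (hf : I.rlp.llp f) : Function.Surjective (fun x : X _⦋0⦌ ↦ f.app (op ⦋0⦌) x) := by
  let S : Set (Y _⦋0⦌) := Set.range (fun x : X _⦋0⦌ ↦ f.app (op ⦋0⦌) x)
  have hS : Subcomplex.range f ≤ fullSubcomplex S := by
    rintro ⟨⟨n⟩⟩ _ ⟨x, rfl⟩ v
    exact ⟨X.map v.op x, NatTrans.naturality_apply f v.op x⟩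
  have sq : CommSq (Subcomplex.lift f hS) f (fullSubcomplex S).ι (𝟙 Y) := ⟨by simp⟩
  have := hf _ (fun _ _ i hi ↦ hasLiftingProperty_fullSubcomplex_ι i (hI i hi) S)
  intro y
  have h := ConcreteCategory.congr_hom (NatTrans.congr_app sq.fac_right (op ⦋0⦌)) y
  have h' := (mem_fullSubcomplex_zero_iff S _).1 (sq.lift.app _ y).2
  exact (show (sq.lift.app (op ⦋0⦌) y).1 = y from h) ▸ h'

/-- By the small object argument, such maps are retracts of transfinite compositions of pushouts of
coproducts of maps in `I`. -/
lemma llp_rlp_le_monomorphisms {I : MorphismProperty SSet.{u}} [HasSmallObjectArgument.{u} I]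
    (hI : I ≤ monomorphisms SSet.{u}) : I.rlp.llp ≤ monomorphisms SSet.{u} := by
  rw [llp_rlp_of_hasSmallObjectArgument', retracts_le_iff]
  refine (transfiniteCompositionsOfShape_monotone _ ?_).trans
    (transfiniteCompositionsOfShape_le (monomorphisms SSet.{u}) _)
  rwa [pushouts_le_iff, coproducts_le_iff]

lemma isBijectiveOnObjects_of_mono (f : X ⟶ Y) [Mono f]
    (hf : Function.Surjective (fun x : X _⦋0⦌ ↦ f.app (op ⦋0⦌) x)) : IsBijectiveOnObjects f :=
  ⟨fun _ _ h ↦ (mono_iff_injective _).1 (inferInstance : Mono (f.app (op ⦋0⦌))) h, hf⟩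

lemma innerAnodyneExtensions.mono {f : X ⟶ Y} (hf : innerAnodyneExtensions f) : Mono f :=
  llp_rlp_le_monomorphisms innerHornInclusions_le_monomorphisms f hf

lemma innerAnodyneExtensions.isBijectiveOnObjects {f : X ⟶ Y} (hf : innerAnodyneExtensions f) :
    IsBijectiveOnObjects f := by
  have := hf.mono
  refine isBijectiveOnObjects_of_mono f (surjective_of_llp_rlp ?_ hf)
  rintro _ _ _ ⟨i, -, -⟩ x
  exact ⟨⟨x, by rw [horn_obj_eq_univ i 0]; trivial⟩, rfl⟩

namespace IsBijectiveOnObjects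

variable {f : X ⟶ Y} {g : Y ⟶ Z}

lemma comp (hf : IsBijectiveOnObjects f) (hg : IsBijectiveOnObjects g) :
    IsBijectiveOnObjects (f ≫ g) :=
  Function.Bijective.comp (g := fun y : Y _⦋0⦌ ↦ g.app (op ⦋0⦌) y)
    (f := fun x : X _⦋0⦌ ↦ f.app (op ⦋0⦌) x) hg hf

lemma of_comp_left (hf : IsBijectiveOnObjects f) (hfg : IsBijectiveOnObjects (f ≫ g)) :
    IsBijectiveOnObjects g :=
  (Function.Bijective.of_comp_iff (fun y : Y _⦋0⦌ ↦ g.app (op ⦋0⦌) y) hf).1 hfg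

lemma of_comp_right (hg : IsBijectiveOnObjects g) (hfg : IsBijectiveOnObjects (f ≫ g)) :
    IsBijectiveOnObjects f :=
  (Function.Bijective.of_comp_iff' hg (fun x : X _⦋0⦌ ↦ f.app (op ⦋0⦌) x)).1 hfg

end IsBijectiveOnObjects

/-- The boundary inclusions `∂Δ[n] ⟶ Δ[n]` for `n ≥ 1`. -/
def positiveBoundaryInclusions : MorphismProperty SSet.{u} :=
  .ofHoms (fun n : ℕ ↦ ∂Δ[n + 1].ι)

attribute [local instance] Cardinal.fact_isRegular_aleph0 Cardinal.orderBotAleph0OrdToType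

instance : MorphismProperty.IsSmall.{u} positiveBoundaryInclusions.{u} :=
  isSmall_ofHoms ..

instance : IsCardinalForSmallObjectArgument positiveBoundaryInclusions.{u} Cardinal.aleph0.{u} where
  preservesColimit {A B X Y} i hi f hf := by
    have : IsFinitelyPresentable.{u} A := by
      obtain ⟨n⟩ := hi
      infer_instance
    infer_instance

instance : HasSmallObjectArgument.{u} positiveBoundaryInclusions.{u} where
  exists_cardinal := ⟨.aleph0, inferInstance, inferInstance, inferInstance⟩

lemma exists_fac_innerAnodyneExtensions (f : X ⟶ Y) :
    ∃ (Z : SSet.{u}) (i : X ⟶ Z) (p : Z ⟶ Y),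
      innerAnodyneExtensions i ∧ innerFibrations p ∧ i ≫ p = f :=
  let h := factorizationData innerHornInclusions.rlp.llp innerHornInclusions.rlp f
  ⟨_, h.i, h.p, h.hi, h.hp, h.fac⟩

lemma exists_innerAnodyneExtensions_quasicategory (X : SSet.{u}) :
    ∃ (Y : SSet.{u}) (i : X ⟶ Y), innerAnodyneExtensions i ∧ Quasicategory Y := by
  obtain ⟨Y, i, p, hi, hp, -⟩ := exists_fac_innerAnodyneExtensions (Limits.terminal.from X)
  exact ⟨Y, i, hi, (quasicategory_iff_of_isTerminal p Limits.terminalIsTerminal).2 ⟨hp⟩⟩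

/-- A map which is bijective on objects factors as a monomorphism which is bijective on objects
followed by a trivial Kan fibration. -/
lemma IsBijectiveOnObjects.exists_fac {f : X ⟶ Y} (hf : IsBijectiveOnObjects f) :
    ∃ (Z : SSet.{u}) (i : X ⟶ Z) (p : Z ⟶ Y),
      Mono i ∧ IsBijectiveOnObjects i ∧ IsTrivialKanFibration p ∧ i ≫ p = f := by
  -- Leaving out `∂Δ[0]` ensures that no vertices are added. Lifting against `∂Δ[0]` is recovered
  -- from bijectivity of the second factor on vertices.
  let h := factorizationData positiveBoundaryInclusions.rlp.llp positiveBoundaryInclusions.rlp f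
  have hi : Mono h.i := by
    refine llp_rlp_le_monomorphisms ?_ h.i h.hi
    rintro _ _ _ ⟨n⟩
    exact monomorphisms.infer_property _
  have hi' : IsBijectiveOnObjects h.i := by
    refine isBijectiveOnObjects_of_mono _ (surjective_of_llp_rlp ?_ h.hi)
    rintro _ _ _ ⟨n⟩ x
    exact ⟨⟨x, by rw [boundary_obj_eq_univ 0 (n + 1)]; trivial⟩, rfl⟩
  refine ⟨_, h.i, h.p, hi, hi', ?_, h.fac⟩
  have hp : IsBijectiveOnObjects h.p := hi'.of_comp_left (by rwa [h.fac])
  rintro (_ | n)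
  · exact hp.hasLiftingProperty_boundary_zero
  · exact h.hp _ ⟨n⟩

/-- If a monomorphism is a categorical equivalence which is bijective on objects, then its
composition with some inner anodyne map is inner anodyne. -/
lemma IsCategoricalEquivalence.exists_comp_innerAnodyneExtensions {f : X ⟶ Y} [Mono f]
    (hf : IsCategoricalEquivalence f) (hf' : IsBijectiveOnObjects f) :
    ∃ (Z : SSet.{u}) (i : Y ⟶ Z), innerAnodyneExtensions i ∧ innerAnodyneExtensions (f ≫ i) := by
  obtain ⟨Z, i, hi, _⟩ := exists_innerAnodyneExtensions_quasicategory Y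
  have := hi.mono
  refine ⟨Z, i, hi, ?_⟩
  obtain ⟨W, j, p, hj, hp, fac⟩ := exists_fac_innerAnodyneExtensions (f ≫ i)
  have : InnerFibration p := ⟨hp⟩
  have : Quasicategory W := quasicategory_of_innerFibration p
  have hp' : IsTrivialKanFibration p := by
    apply isTrivialKanFibration_of_quasicategory hp
    · refine hj.isBijectiveOnObjects.of_comp_left ?_
      rw [fac]
      exact hf'.comp hi.isBijectiveOnObjects
    · refine (isCategoricalEquivalence_of_innerAnodyneExtensions hj).of_comp_left ?_
      rw [fac]
      exact hf.comp (isCategoricalEquivalence_of_innerAnodyneExtensions hi)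
  have := hp'.rlp _ (monomorphisms.infer_property (f ≫ i))
  exact of_retract (RetractArrow.ofLeftLiftingProperty fac) hj

end

end SSet


/-! ### The equivalence of the three statements -/

theorem mainTheorem11 :
    List.TFAE
      [ -- inner anodyne maps have the 2-out-of-3 property in the class of monomorphisms
        ∀ (A B C : SSet.{u}) (f : A ⟶ B) (g : B ⟶ C), Mono f → Mono g →
          (SSet.innerAnodyneExtensions f → SSet.innerAnodyneExtensions g →
            SSet.innerAnodyneExtensions (f ≫ g)) ∧
          (SSet.innerAnodyneExtensions f → SSet.innerAnodyneExtensions (f ≫ g) →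
            SSet.innerAnodyneExtensions g) ∧
          (SSet.innerAnodyneExtensions g → SSet.innerAnodyneExtensions (f ≫ g) →
            SSet.innerAnodyneExtensions f),
        -- monic categorical equivalences that are bijective on objects are inner anodyne
        ∀ (A B : SSet.{u}) (f : A ⟶ B), Mono f → SSet.IsCategoricalEquivalence f →
          SSet.IsBijectiveOnObjects f → SSet.innerAnodyneExtensions f,
        -- inner fibrations that are bijective on objects and categorical equivalences
        -- are trivial Kan fibrations
        ∀ (X S : SSet.{u}) (p : X ⟶ S), SSet.innerFibrations p → SSet.IsBijectiveOnObjects p →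
          SSet.IsCategoricalEquivalence p → SSet.IsTrivialKanFibration p ] := by
  tfae_have 1 → 2 := fun h A B f hf hf₁ hf₂ ↦ by
    obtain ⟨C, i, hi, hfi⟩ := hf₁.exists_comp_innerAnodyneExtensions hf₂
    exact (h A B C f i hf hi.mono).2.2 hi hfi
  tfae_have 2 → 1 := fun h A B C f g hf hg ↦
    ⟨fun hf' hg' ↦ MorphismProperty.comp_mem _ _ _ hf' hg',
      fun hf' hfg' ↦ h _ _ _ hg
        ((SSet.isCategoricalEquivalence_of_innerAnodyneExtensions hf').of_comp_left
          (SSet.isCategoricalEquivalence_of_innerAnodyneExtensions hfg'))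
        (hf'.isBijectiveOnObjects.of_comp_left hfg'.isBijectiveOnObjects),
      fun hg' hfg' ↦ h _ _ _ hf
        ((SSet.isCategoricalEquivalence_of_innerAnodyneExtensions hg').of_comp_right
          (SSet.isCategoricalEquivalence_of_innerAnodyneExtensions hfg'))
        (hg'.isBijectiveOnObjects.of_comp_right hfg'.isBijectiveOnObjects)⟩
  tfae_have 3 → 2 := fun h A B f hf hf₁ hf₂ ↦ by
    obtain ⟨E, j, p, hj, hp, fac⟩ := SSet.exists_fac_innerAnodyneExtensions f
    have hp' : SSet.IsTrivialKanFibration p := h _ _ p hp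
      (hj.isBijectiveOnObjects.of_comp_left (by rwa [fac]))
      ((SSet.isCategoricalEquivalence_of_innerAnodyneExtensions hj).of_comp_left (by rwa [fac]))
    have := hp'.rlp _ (MorphismProperty.monomorphisms.infer_property f)
    exact MorphismProperty.of_retract (RetractArrow.ofLeftLiftingProperty fac) hj
  tfae_have 2 → 3 := fun h X S p hp hp₁ hp₂ ↦ by
    obtain ⟨Y, i, q, hi, hi', hq, fac⟩ := hp₁.exists_fac
    have hi'' : SSet.innerAnodyneExtensions i := h _ _ i hi
      ((SSet.isCategoricalEquivalence_of_rlp hq.rlp).of_comp_right (by rwa [fac])) hi'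
    -- As `i` lifts against `p`, the map `p` is a retract of the trivial fibration `q`.
    have := hi'' _ hp
    exact SSet.isTrivialKanFibration_of_rlp
      (MorphismProperty.of_retract (RetractArrow.ofRightLiftingProperty fac) hq.rlp)
  tfae_finish
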